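/- **Setting.** Let $\mathcal K$ be a finite set of nodes, $H$ a real normed space of scalar signals (for instance $L^2$ of a probability space, or sample vectors), and let node $k$ observe a signal $y_k\in H^{M_k}$. A filter is a block column $X=[X_1;\dots;X_K]$ with $X_k\in\mathbb R^{M_k\times Q}$, and $X^Ty=\sum_k X_k^Ty_k\in H^Q$. For matrices $A_k,D_{j,k}$ with $M_k$ rows, $A=\mathrm{blkdiag}(A_k)$ and $B=[B_1;\dots;B_K]$, the centralized problem is $$\min_X\; L(X)=f(X)+g(X),\quad f(X)=\varphi(X^Ty,X^TB),\quad g(X)=\gamma(X^TA)=\sum_k\gamma_k(X_k^TA_k),\qquad X\in\mathcal X,$$ $$\mathcal X=\{X:\ \vartheta^k_j(X_k)\le 0\ (j\in\mathcal J_I^k),\ \ \vartheta^k_j(X_k)=0\ (j\in\mathcal J_E^k),\ k\in\mathcal K\},\qquad \vartheta_j^k(X_k)=\eta_j(X_k^Ty_k,X_k^TD_{j,k}).$$ Here the index sets are finite, the real-valued functions $\eta_j$ are $C^1$, $\varphi$ is real-valued and $C^1$ near every argument $(X^Ty,X^TB)$ with $X\in\mathcal X$, and $\gamma$ is real-valued.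 **Algorithm.** Let $X^0$ be arbitrary. At iteration $i$ there is an updating node $q=q^i$, and the other nodes are partitioned into branches $\mathcal B_{nq}$, one for each neighbour $n\in\mathcal N_q$ of $q$. In a fully-connected network (Algorithm 1), $\mathcal N_q=\mathcal K\setminus\{q\}$ and $\mathcal B_{nq}=\{n\}$. In a network with a connected graph (Algorithm 2), a spanning tree that contains all links of $q$ is chosen, and $\mathcal B_{nq}$ is the set of nodes on the side of $n$ when the link $nq$ is removed from the tree; the tree may change with $i$. For a current filter $X$, the local data consist of the aggregated data $$\tilde y=\Big[y_q;\ \big(\textstyle\sum_{l\in\mathcal B_{nq}}X_l^Ty_l\big)_{n\in\mathcal N_q}\Big],\qquad \tilde B=\Big[B_q;\ \big(\textstyle\sum_{l\in\mathcal B_{nq}}X_l^TB_l\big)_{n\in\mathcal N_q}\Big],$$ and of the per-node data $(\hat y_l,\hat A_l,\hat D_{j,l})=(X_l^Ty_l,X_l^TA_l,X_l^TD_{j,l})$ for $l\ne q$ and $(\hat y_q,\hat A_q,\hat D_{j,q})=(y_q,A_q,D_{j,q})$. The local problem at $(q,X)$ has the variable $\tilde X=[\tilde X_q;(\tilde X_n)_{n\in\mathcal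 N_q}]$, where $\tilde X_q\in\mathbb R^{M_q\times Q}$ and $\tilde X_n\in\mathbb R^{Q\times Q}$. Writing $n(q)=q$ and $n(l)=n$ for $l\in\mathcal B_{nq}$, it is to minimize $$\varphi(\tilde X^T\tilde y,\tilde X^T\tilde B)+\gamma\big([\tilde X_{n(l)}^T\hat A_l]_{l\in\mathcal K}\big)$$ subject to $\eta_j(\tilde X_{n(l)}^T\hat y_l,\tilde X_{n(l)}^T\hat D_{j,l})\le 0$ for $j\in\mathcal J^l_I$ and $=0$ for $j\in\mathcal J^l_E$, for all $l\in\mathcal K$. Any global solution $\tilde X$ of the local problem at $(q^i,X^i)$ is selected, and $X_q^{i+1}=\tilde X_q$, $X_l^{i+1}=X_l^i\tilde X_{n}$ for $l\in\mathcal B_{nq}$. **Theorem (convergence and optimality).** Let $(X^i)$ be generated by NS-DASF in a fully-connected network or in an arbitrary connected network. Suppose that there is a $T$ such that every node is the updating node at least once in any $T$ consecutive iterations (for instance, the nodes update cyclically). Assume: 1. (Continuity, compactness, regularizer) $L$ is continuous on $\mathcal X$, the sets $\{X\in\mathcal X: L(X)\le c\}$ are compact for all $c\in\mathbb R$, and $\gamma$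 is convex (being real-valued, it is then also closed and proper). 2. (Similar solutions) For every updating node with its branches and every $X\in\prod_k\mathbb R^{M_k\times Q}$, the updated filters that result from any two solutions of the local problem at $X$ have the same column space. 3. (Feasible set continuity) For every updating node with its branches, the set-valued map that sends constraint data $(\hat y_l,\hat D_{j,l})_{l,j}$ to the feasible set of the local problem is upper (outer) and lower (inner) semicontinuous relative to the set of those constraint data that come from some $X\in\prod_k\mathbb R^{M_k\times Q}$ and for which the feasible set is non-empty. 4. (Qualification) At every accumulation point $X$ of $(X^i)$, for every updating node $q$ with its branches and every $n\in\mathcal N_q$, the matrices $X_l^T\nabla\vartheta^l_j(X_l)$, where $l\in\mathcal B_{nq}$ and $j$ runs over the equality constraints and the inequality constraints of node $l$ that are active at $X$, form a linearly independent family. Then $(X^i)$ converges to the set of stationary points of the centralized problem: for every $\delta>0$ there is an $I$ such that for all $i>I$ there is an $X^\circ\in\mathcal X$ with $$0\in\nabla f(X^\circ)+\partial g(X^\circ)+N_{\mathcal X}(X^\circ)\qquad\text{and}\qquad \|X^\circ-X^i\|_F<\delta,$$ where $\partial g$ is the convex subdifferential and $N_{\mathcal X}$ the (limiting) normal cone.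 -/

import Mathlib

open Filter Topology Matrix
open scoped Matrix.Norms.Elementwise

noncomputable section

namespace NSDASF

/-! ## Block matrices with `Q` columns -/

/-- A block column of real matrices with `Q` columns; the block with index `n` has `r n` rows.
A filter `X = [X_1; …; X_K]` is a `Blocks M Q`. -/
abbrev Blocks {ι : Type*} (r : ι → ℕ) (Q : ℕ) : Type _ := ∀ n, Matrix (Fin (r n)) (Fin Q) ℝ

section Geometry

variable {ι : Type*} [Fintype ι] {r : ι → ℕ} {Q : ℕ}

/-- The Frobenius inner product. -/
def frobInner (U V : Blocks r Q) : ℝ := ∑ n, ((U n)ᵀ * V n).trace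

/-- The Frobenius norm. -/
def frobNorm (U : Blocks r Q) : ℝ := Real.sqrt (frobInner U U)

/-- The column space of the stacked matrix `X`. -/
def columnSpace (X : Blocks r Q) : Submodule ℝ (∀ n, Fin (r n) → ℝ) :=
  Submodule.span ℝ (Set.range fun (c : Fin Q) (n : ι) (i : Fin (r n)) => X n i c)

/-- Regular normals to `C` at `X`: the `V` with `⟨V, X' - X⟩ ≤ o(‖X' - X‖)` for `X' ∈ C`. -/
def regularNormalCone (C : Set (Blocks r Q)) (X : Blocks r Q) : Set (Blocks r Q) :=
  {V | X ∈ C ∧ ∀ ε : ℝ, 0 < ε → ∀ᶠ X' in 𝓝[C] X, frobInner V (X' - X) ≤ ε * frobNorm (X' - X)}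

/-- The (general, or limiting) normal cone of variational analysis: limits of regular normals at
points of `C` that converge to `X`. -/
def normalCone (C : Set (Blocks r Q)) (X : Blocks r Q) : Set (Blocks r Q) :=
  {V | X ∈ C ∧ ∃ (Xs Vs : ℕ → Blocks r Q), (∀ t, Xs t ∈ C) ∧ (∀ t, Vs t ∈ regularNormalCone C (Xs t))
    ∧ Tendsto Xs atTop (𝓝 X) ∧ Tendsto Vs atTop (𝓝 V)}

/-- The subdifferential of a convex function. -/
def subdifferential (g : Blocks r Q → ℝ) (X : Blocks r Q) : Set (Blocks r Q) :=
  {S | ∀ U, g X + frobInner S (U - X) ≤ g U}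

/-- The gradient of a function of a block matrix (the array of its partial derivatives). -/
def blockGradient [DecidableEq ι] (f : Blocks r Q → ℝ) (X : Blocks r Q) : Blocks r Q :=
  fun n => Matrix.of fun i c => fderiv ℝ f X (Pi.single n (Matrix.single i c 1))

end Geometry

/-- The gradient of a function of one matrix. -/
def matrixGradient {m Q : ℕ} (f : Matrix (Fin m) (Fin Q) ℝ → ℝ) (X : Matrix (Fin m) (Fin Q) ℝ) :
    Matrix (Fin m) (Fin Q) ℝ :=
  Matrix.of fun i c => fderiv ℝ f X (Matrix.single i c 1)

/-- Continuity of a set-valued map relative to the set `s`: at every point of `s` it is upper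
(outer) semicontinuous and lower (inner) semicontinuous relative to `s`. -/
def SetValuedContinuousOn {α β : Type*} [TopologicalSpace α] [TopologicalSpace β]
    (F : α → Set β) (s : Set α) : Prop :=
  ∀ x ∈ s, ∀ xs : ℕ → α, (∀ t, xs t ∈ s) → Tendsto xs atTop (𝓝 x) →
    (∀ (us : ℕ → β) (u : β), (∀ t, us t ∈ F (xs t)) → Tendsto us atTop (𝓝 u) → u ∈ F x) ∧
    (∀ u ∈ F x, ∃ us : ℕ → β, (∀ t, us t ∈ F (xs t)) ∧ Tendsto us atTop (𝓝 u))

/-! ## The family of problems `ℙ(y, A, B, D)` -/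

section Problem

variable {V : Type*} [Fintype V] [DecidableEq V]
variable {H : Type*} [NormedAddCommGroup H] [NormedSpace ℝ H]

/-- `Xᵀ y`, for a vector `y` of scalar signals (elements of the signal space `H`). -/
def filterSignal {m p : ℕ} (X : Matrix (Fin m) (Fin p) ℝ) (y : Fin m → H) : Fin p → H :=
  fun c => ∑ i, X i c • y i

variable (V H) in
/-- The functions that define the problem. `H` is the space of scalar signals (for instance the
square integrable random variables, or sample vectors), `Q` the number of filter outputs, `b` and
`a k` the number of columns of `B` and `A_k`. Node `k` has `nI k` inequality constraints and `nE k`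
equality constraints; `d k j` is the number of columns of `D_{j,k}`.
The argument of `γ` is the row `[X_1ᵀ A_1, …, X_Kᵀ A_K]`, i.e. `Xᵀ A` for block diagonal `A`. -/
structure Functions where
  Q : ℕ
  b : ℕ
  a : V → ℕ
  nI : V → ℕ
  nE : V → ℕ
  d : ∀ k, Fin (nI k) ⊕ Fin (nE k) → ℕ
  φ : (Fin Q → H) → Matrix (Fin Q) (Fin b) ℝ → ℝ
  γ : (∀ k, Matrix (Fin Q) (Fin (a k)) ℝ) → ℝ
  η : ∀ k j, (Fin Q → H) → Matrix (Fin Q) (Fin (d k j)) ℝ → ℝ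

/-- The data on which the constraints depend: for every node `k`, a signal and the matrices
`D_{j,k}`. Node `k` acts on the variable block `β k`, which has `r (β k)` rows. -/
abbrev Functions.ConstraintData (P : Functions V H) {ι : Type*} (r : ι → ℕ) (β : V → ι) : Type _ :=
  (∀ k, Fin (r (β k)) → H) × (∀ k j, Matrix (Fin (r (β k))) (Fin (P.d k j)) ℝ)

/-- The data of an optimization problem in the variable `X : Blocks r Q`: the stacked signal `y`
and matrix `B`, the diagonal blocks `A k`, and the constraint data. In the centralized problem
`β` is the identity. -/
structure Functions.Data (P : Functions V H) {ι : Type*} (r : ι → ℕ) (β : V → ι) where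
  y : ∀ n, Fin (r n) → H
  B : ∀ n, Matrix (Fin (r n)) (Fin P.b) ℝ
  A : ∀ k, Matrix (Fin (r (β k))) (Fin (P.a k)) ℝ
  con : P.ConstraintData r β

variable (P : Functions V H)

/-- The set-valued map `(y, D) ↦ 𝒳(y, D)`. -/
def Functions.feasibleSet {ι : Type*} {r : ι → ℕ} {β : V → ι} (c : P.ConstraintData r β) :
    Set (Blocks r P.Q) :=
  {X | ∀ k,
    (∀ j, P.η k (Sum.inl j) (filterSignal (X (β k)) (c.1 k)) ((X (β k))ᵀ * c.2 k (Sum.inl j)) ≤ 0) ∧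
    (∀ j, P.η k (Sum.inr j) (filterSignal (X (β k)) (c.1 k)) ((X (β k))ᵀ * c.2 k (Sum.inr j)) = 0)}

section Objective

variable {ι : Type*} [Fintype ι] {r : ι → ℕ} {β : V → ι}

/-- The filter output `Xᵀ y`. -/
def Functions.output (dat : P.Data r β) (X : Blocks r P.Q) : Fin P.Q → H :=
  ∑ n, filterSignal (X n) (dat.y n)

/-- The product `Xᵀ B`. -/
def Functions.outputB (dat : P.Data r β) (X : Blocks r P.Q) : Matrix (Fin P.Q) (Fin P.b) ℝ :=
  ∑ n, (X n)ᵀ * dat.B n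

/-- `f(X) = φ(Xᵀ y, Xᵀ B)`. -/
def Functions.smoothPart (dat : P.Data r β) (X : Blocks r P.Q) : ℝ :=
  P.φ (P.output dat X) (P.outputB dat X)

/-- `g(X) = γ(Xᵀ A)`. -/
def Functions.regularizer (dat : P.Data r β) (X : Blocks r P.Q) : ℝ :=
  P.γ fun k => (X (β k))ᵀ * dat.A k

/-- `L = f + g`. -/
def Functions.objective (dat : P.Data r β) (X : Blocks r P.Q) : ℝ :=
  P.smoothPart dat X + P.regularizer dat X

/-- `X` is a (global) solution of the problem `ℙ` with the given data. -/
def Functions.IsSolution (dat : P.Data r β) (X : Blocks r P.Q) : Prop :=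
  X ∈ P.feasibleSet dat.con ∧ ∀ U ∈ P.feasibleSet dat.con, P.objective dat X ≤ P.objective dat U

end Objective

/-! ## Data aggregation and local problems -/

/-- How the data are aggregated in one iteration: the updating node `q`, the set `nbr` of its
neighbours, and, for every other node, the neighbour of `q` to whose branch it belongs. -/
structure Aggregation (V : Type*) where
  q : V
  nbr : Finset V
  branch : ∀ l, l ≠ q → {n // n ∈ nbr}

/-- Aggregation in a fully-connected network: each node forms a branch by itself. -/
def Aggregation.full (q : V) : Aggregation V where
  q := q
  nbr := Finset.univ.erase q
  branch := fun l hl => ⟨l, Finset.mem_erase.mpr ⟨hl, Finset.mem_univ l⟩⟩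

/-- The branch `ℬ_{nq}` of the tree `T`: the nodes on the side of `n` when the link between `n`
and `q` is removed. -/
def branchSet (T : SimpleGraph V) (n q : V) : Set V :=
  {l | (T.deleteEdges {s(n, q)}).Reachable n l}

/-- The aggregation `agg` is the one along the tree `T`, rooted at the updating node. -/
def Aggregation.IsAlongTree (agg : Aggregation V) (T : SimpleGraph V) : Prop :=
  (∀ n, n ∈ agg.nbr ↔ T.Adj agg.q n) ∧
  ∀ l (hl : l ≠ agg.q), l ∈ branchSet T (agg.branch l hl) agg.q

namespace Aggregation

variable (M : V → ℕ) (agg : Aggregation V)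

/-- The blocks of the local variable `[X̃_q; X̃_{n_1}; …; X̃_{n_L}]`. -/
abbrev Index : Type _ := Option {n // n ∈ agg.nbr}

/-- The number of rows of the blocks of the local variable. -/
abbrev rows (Q : ℕ) : agg.Index → ℕ
  | none => M agg.q
  | some _ => Q

/-- The block of the local variable by which node `l` updates its filter. -/
def block (l : V) : agg.Index :=
  if hl : l = agg.q then none else some (agg.branch l hl)

variable {M}

/-- The compression matrix of node `l` towards the local block `n`. In the block of the updating
node it is the identity matrix for `l = q`; in any other block it is the current filter `X_l`. -/
def compressor {Q : ℕ} (X : Blocks M Q) (l : V) :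
    ∀ n : agg.Index, Matrix (Fin (M l)) (Fin (agg.rows M Q n)) ℝ
  | none => Matrix.of fun i j => if (⟨l, i⟩ : Σ k, Fin (M k)) = ⟨agg.q, j⟩ then 1 else 0
  | some _ => X l

set_option linter.unusedSectionVars false in
/-- The updating node does not compress its own data. -/
theorem compressor_self {Q : ℕ} (X : Blocks M Q) :
    agg.compressor X agg.q none = (1 : Matrix (Fin (M agg.q)) (Fin (M agg.q)) ℝ) := by
  refine Matrix.ext fun (i j : Fin (M agg.q)) => ?_
  change (if (⟨agg.q, i⟩ : Σ k, Fin (M k)) = ⟨agg.q, j⟩ then (1 : ℝ) else 0) =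
    (1 : Matrix (Fin (M agg.q)) (Fin (M agg.q)) ℝ) i j
  rw [Matrix.one_apply]
  exact if_congr (by constructor <;> intro h <;> simpa using h) rfl rfl

/-- The filters after the parameter update with the local variable `W`: the updating node takes
over its block of `W`, and every other node right-multiplies its filter by the block of its
branch. -/
def update {Q : ℕ} (X : Blocks M Q) (W : Blocks (agg.rows M Q) Q) : Blocks M Q :=
  fun l => agg.compressor X l (agg.block l) * W (agg.block l)

end Aggregation

/-- The data of a network with `M k` channels at node `k`: the signals `y_k`, the diagonal blocks
`A_k`, the block rows `B_k` and the matrices `D_{j,k}`. -/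
structure Functions.GlobalData (P : Functions V H) (M : V → ℕ) where
  y : ∀ k, Fin (M k) → H
  A : ∀ k, Matrix (Fin (M k)) (Fin (P.a k)) ℝ
  B : ∀ k, Matrix (Fin (M k)) (Fin P.b) ℝ
  D : ∀ k j, Matrix (Fin (M k)) (Fin (P.d k j)) ℝ

variable {P} {M : V → ℕ}

/-- The data of the centralized problem. -/
def Functions.GlobalData.central (dat : P.GlobalData M) : P.Data M (fun k => k) where
  y := dat.y
  B := dat.B
  A := dat.A
  con := (dat.y, dat.D)

/-- The data available at the updating node when the current filter is `X`: the signals and the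
matrices `B_l` are compressed and summed over each branch, the matrices `A_l`, `D_{j,l}` and the
signals in the constraints are compressed for each node separately. -/
def Functions.GlobalData.localData (dat : P.GlobalData M) (agg : Aggregation V)
    (X : Blocks M P.Q) : P.Data (agg.rows M P.Q) agg.block where
  y := fun n => ∑ l with agg.block l = n, filterSignal (agg.compressor X l n) (dat.y l)
  B := fun n => ∑ l with agg.block l = n, (agg.compressor X l n)ᵀ * dat.B l
  A := fun l => (agg.compressor X l (agg.block l))ᵀ * dat.A l
  con :=
    (fun l => filterSignal (agg.compressor X l (agg.block l)) (dat.y l),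
     fun l j => (agg.compressor X l (agg.block l))ᵀ * dat.D l j)

/-! ## The algorithms -/

namespace Functions.GlobalData

variable (dat : P.GlobalData M)

/-- One iteration: the local problem is solved, any of its solutions is selected, and the filters
are updated. -/
def Step (agg : Aggregation V) (X X' : Blocks M P.Q) : Prop :=
  ∃ W, P.IsSolution (dat.localData agg X) W ∧ X' = agg.update X W

/-- `X` is generated by NS-DASF in a fully-connected network. -/
def IsFullyConnectedRun (agg : ℕ → Aggregation V) (X : ℕ → Blocks M P.Q) : Prop :=
  (∀ i, agg i = Aggregation.full (agg i).q) ∧ ∀ i, dat.Step (agg i) (X i) (X (i + 1))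

/-- `X` is generated by NS-DASF in a network with graph `G`: in every iteration the data are
aggregated along a spanning tree that keeps all the links of the updating node. -/
def IsTreeRun (G : SimpleGraph V) (agg : ℕ → Aggregation V) (X : ℕ → Blocks M P.Q) : Prop :=
  (∀ i, ∃ T : SimpleGraph V, T ≤ G ∧ T.IsTree ∧ (∀ n, G.Adj (agg i).q n → T.Adj (agg i).q n) ∧
    (agg i).IsAlongTree T) ∧
  ∀ i, dat.Step (agg i) (X i) (X (i + 1))

/-! ## Assumptions -/

/-- The feasible set `𝒳` of the centralized problem. -/
def feasible : Set (Blocks M P.Q) := P.feasibleSet dat.central.con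

/-- The standing regularity of the problem: `φ` is continuously differentiable (near the arguments
that feasible filters produce), and so are the functions `η_j`. -/
def Smooth : Prop :=
  (∀ X ∈ dat.feasible, ContDiffAt ℝ 1 (Function.uncurry P.φ) (P.output dat.central X, P.outputB dat.central X)) ∧
  ∀ k j, ContDiff ℝ 1 (Function.uncurry (P.η k j))

/-- `γ` is per-node block separable. -/
def BlockSeparable : Prop :=
  ∃ γk : ∀ k, Matrix (Fin P.Q) (Fin (P.a k)) ℝ → ℝ,
    ∀ X : Blocks M P.Q, P.regularizer dat.central X = ∑ k, γk k ((X k)ᵀ * dat.A k)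

/-- Continuity, compact sublevel sets and convex regularizer. As `γ` is a finite function on a
finite-dimensional space, convexity makes it closed and proper. -/
def ContinuityAssumption : Prop :=
  ContinuousOn (P.objective dat.central) dat.feasible ∧
  (∀ c : ℝ, IsCompact {X | X ∈ dat.feasible ∧ P.objective dat.central X ≤ c}) ∧
  ConvexOn ℝ Set.univ P.γ

/-- Similar solutions: any two solutions of the same local problem produce filters with the same
column space. -/
def SimilarSolutions (agg : Aggregation V) : Prop :=
  ∀ (X : Blocks M P.Q) (W W' : Blocks (agg.rows M P.Q) P.Q),
    P.IsSolution (dat.localData agg X) W → P.IsSolution (dat.localData agg X) W' →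
    columnSpace (agg.update X W) = columnSpace (agg.update X W')

/-- Continuity of the feasible-set map `(y, D) ↦ 𝒳(y, D)`, on the compressed data that the updating
node can receive and for which the local problem is feasible. -/
def FeasibleSetContinuity (agg : Aggregation V) : Prop :=
  SetValuedContinuousOn
    (fun c : P.ConstraintData (agg.rows M P.Q) agg.block => P.feasibleSet c)
    {c | (∃ X : Blocks M P.Q, c = (dat.localData agg X).con) ∧ (P.feasibleSet c).Nonempty}

/-- The constraint function `ϑ_j^k : X_k ↦ η_j(X_kᵀ y_k, X_kᵀ D_{j,k})`. -/
def nodeConstraint (k : V) (j : Fin (P.nI k) ⊕ Fin (P.nE k)) (Xk : Matrix (Fin (M k)) (Fin P.Q) ℝ) :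
    ℝ :=
  P.η k j (filterSignal Xk (dat.y k)) (Xkᵀ * dat.D k j)

/-- The constraint `j` of node `k` is an equality constraint or an active inequality constraint
at `X`. -/
def IsActive (X : Blocks M P.Q) (k : V) : Fin (P.nI k) ⊕ Fin (P.nE k) → Prop
  | Sum.inl j => dat.nodeConstraint k (Sum.inl j) (X k) = 0
  | Sum.inr _ => True

/-- The compressed LICQ-type qualification at `X`: for every branch `n` of the updating node, the
compressed gradients `X_lᵀ ∇ϑ_j^l(X_l)` of the equality and active inequality constraints of all
nodes `l` of the branch are linearly independent. -/
def CompressedLICQ (agg : Aggregation V) (X : Blocks M P.Q) : Prop :=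
  ∀ n : {n // n ∈ agg.nbr}, LinearIndependent ℝ
    fun p : {p : Σ l, Fin (P.nI l) ⊕ Fin (P.nE l) //
        agg.block p.1 = some n ∧ dat.IsActive X p.1 p.2} =>
      (X p.1.1)ᵀ * matrixGradient (dat.nodeConstraint p.1.1 p.1.2) (X p.1.1)

/-! ## Stationarity -/

/-- The stationary points `0 ∈ ∇f(X) + ∂g(X) + N_𝒳(X)` of the centralized problem. -/
def stationaryPoints : Set (Blocks M P.Q) :=
  {X | X ∈ dat.feasible ∧ ∃ S ∈ subdifferential (P.regularizer dat.central) X,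
    ∃ N ∈ normalCone dat.feasible X, blockGradient (P.smoothPart dat.central) X + S + N = 0}

end Functions.GlobalData

end Problem

end NSDASF

end

set_option linter.unusedSectionVars false

namespace NSDASF

/-! ### Compression and sums of signals -/

section Signals

variable {H : Type*} [NormedAddCommGroup H] [NormedSpace ℝ H]

/-! A local problem is the centralized problem restricted to the filters `agg.update X W`. The
current filter is one of them, so the objective decreases from iteration 1 on and the iterates stay
in a compact sublevel set. Along an ultrafilter finer than `atTop`, every shifted sequence `X (i +
s)` therefore has a limit `Y s`, all these limits have the same objective value, and, there being
finitely many aggregations, the one used at `i + s` is eventually a fixed `a s`.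

The core is the passage to the limit in one iteration (`limit_step`). The limit filter may lose
rank, and the limit after the update need not be an update of the limit before it. The branches are
therefore replaced by Gram-Schmidt generators, which give the same updates and have bounded entries
(`exists_normalization`). The generators converge to some `Gb`, and both `Y s` and `Y (s + 1)` are
updates of `Gb`. Inner semicontinuity of the feasible set makes `Y (s + 1)` a solution at `Gb`; `Y
s` has the same value, hence is also a solution. Similar solutions then give equal column spaces.

Consequently `Y 0` equals `Y s` times a square matrix for every `s`. Replacing the block of the node
updating at time `s` in `Y 0` is thus an update of `Y s` and cannot lower the objective. Every node
updates at some such `s`, so `Y 0` is minimal in each block separately. As the constraints and the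
regularizer separate over the nodes and `f` is differentiable, the blockwise inequalities add up to
a first-order condition (`linearized_min_of_blockwise_min`). A sum rule
(`exists_subgradient_limiting_normal`) splits this into a subgradient and a limiting normal, so `Y
0` is stationary. -/

theorem filterSignal_mul {m p r : ℕ} (C : Matrix (Fin m) (Fin p) ℝ) (W : Matrix (Fin p) (Fin r) ℝ)
    (y : Fin m → H) : filterSignal (C * W) y = filterSignal W (filterSignal C y) := by
  ext c
  simp only [filterSignal, Matrix.mul_apply, Finset.sum_smul, Finset.smul_sum, smul_smul]
  rw [Finset.sum_comm]
  simp only [mul_comm]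

theorem filterSignal_sum {κ : Type*} {m p : ℕ} (s : Finset κ) (X : Matrix (Fin m) (Fin p) ℝ)
    (y : κ → Fin m → H) : filterSignal X (∑ l ∈ s, y l) = ∑ l ∈ s, filterSignal X (y l) := by
  ext c
  simp only [filterSignal, Finset.sum_apply, Finset.smul_sum]
  rw [Finset.sum_comm]

theorem continuous_filterSignal {m p : ℕ} (y : Fin m → H) :
    Continuous fun X : Matrix (Fin m) (Fin p) ℝ => filterSignal X y := by
  unfold filterSignal
  fun_prop

end Signals

theorem sum_fiber_apply {α β E : Type*} [Fintype α] [Fintype β] [DecidableEq β]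
    [AddCommMonoid E] (b : α → β) (F : α → β → E) :
    ∑ n, ∑ l with b l = n, F l n = ∑ l, F l (b l) := by
  simp only [Finset.sum_filter]
  rw [Finset.sum_comm]
  simp

theorem tendsto_matrix_mul {κ : Type*} {F : Filter κ} {m p n : ℕ}
    {A : κ → Matrix (Fin m) (Fin p) ℝ} {B : κ → Matrix (Fin p) (Fin n) ℝ}
    {a : Matrix (Fin m) (Fin p) ℝ} {b : Matrix (Fin p) (Fin n) ℝ}
    (hA : Tendsto A F (𝓝 a)) (hB : Tendsto B F (𝓝 b)) :
    Tendsto (fun i => A i * B i) F (𝓝 (a * b)) := by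
  have h : Continuous fun x : Matrix (Fin m) (Fin p) ℝ × Matrix (Fin p) (Fin n) ℝ => x.1 * x.2 :=
    continuous_fst.matrix_mul continuous_snd
  exact (h.tendsto (a, b)).comp (hA.prodMk_nhds hB)

/-! ### Updates, branchwise normalization and column spaces -/

section Update

variable {V : Type*} [Fintype V] [DecidableEq V] {M : V → ℕ} (agg : Aggregation V) {Q : ℕ}

namespace Aggregation

theorem block_self : agg.block agg.q = none := by simp [block]

theorem block_eq_none {l : V} : agg.block l = none ↔ l = agg.q := by
  unfold block
  split_ifs <;> simp_all

theorem update_self (X : Blocks M Q) (W : Blocks (agg.rows M Q) Q) :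
    agg.update X W agg.q = W none := by
  have h : ∀ b, b = none →
      (agg.compressor X agg.q b * W b : Matrix (Fin (M agg.q)) (Fin Q) ℝ) = W none := by
    rintro _ rfl
    rw [agg.compressor_self]
    exact Matrix.one_mul _
  exact h _ agg.block_self

theorem update_of_block (X : Blocks M Q) (W : Blocks (agg.rows M Q) Q) {l : V}
    {n : {n // n ∈ agg.nbr}} (hl : agg.block l = some n) :
    agg.update X W l = (X l * W (some n) : Matrix (Fin (M l)) (Fin Q) ℝ) := by
  have h : ∀ b, b = some n →
      (agg.compressor X l b * W b : Matrix (Fin (M l)) (Fin Q) ℝ) = X l * W (some n) := by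
    rintro _ rfl
    rfl
  exact h _ hl

/-- The local variable that replaces the filter of the updating node by `U` and multiplies the
filters of branch `n` by `R n`. -/
def localVariable (U : Matrix (Fin (M agg.q)) (Fin Q) ℝ)
    (R : {n // n ∈ agg.nbr} → Matrix (Fin Q) (Fin Q) ℝ) : Blocks (agg.rows M Q) Q
  | none => U
  | some n => R n

theorem update_localVariable_one (X : Blocks M Q) (U : Matrix (Fin (M agg.q)) (Fin Q) ℝ) :
    agg.update X (agg.localVariable U fun _ => 1) = Function.update X agg.q U := by
  funext l
  rcases hl : agg.block l with _ | n
  · obtain rfl := agg.block_eq_none.1 hl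
    rw [update_self]
    simp [localVariable]
  · have : l ≠ agg.q := fun h => by simp [agg.block_eq_none.2 h] at hl
    rw [update_of_block _ _ _ hl, Function.update_of_ne this]
    exact Matrix.mul_one _

/-- If each branch of `X` arises from `Y` by right multiplication, then every update of `X` is an
update of `Y`. -/
theorem exists_update_eq {X Y : Blocks M Q} (R : {n // n ∈ agg.nbr} → Matrix (Fin Q) (Fin Q) ℝ)
    (h : ∀ l n, agg.block l = some n → X l = Y l * R n) (W : Blocks (agg.rows M Q) Q) :
    ∃ W', agg.update X W = agg.update Y W' := by
  refine ⟨agg.localVariable (W none) fun n => R n * (W (some n) : Matrix (Fin Q) (Fin Q) ℝ), ?_⟩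
  funext l
  rcases hl : agg.block l with _ | n
  · obtain rfl := agg.block_eq_none.1 hl
    rw [update_self, update_self]
    rfl
  · rw [update_of_block _ _ _ hl, update_of_block _ _ _ hl, h l n hl]
    exact Matrix.mul_assoc _ _ _

theorem exists_update_update (X : Blocks M Q) (W W' : Blocks (agg.rows M Q) Q) :
    ∃ W'', agg.update (agg.update X W) W' = agg.update X W'' :=
  agg.exists_update_eq (fun n => W (some n)) (fun _ _ hl => update_of_block _ _ _ hl) W'

theorem continuous_compressor (l : V) (n : agg.Index) :
    Continuous fun X : Blocks M Q => agg.compressor X l n := by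
  rcases n with _ | n
  · exact continuous_const
  · exact continuous_apply l

theorem continuous_update :
    Continuous fun p : Blocks M Q × Blocks (agg.rows M Q) Q => agg.update p.1 p.2 := by
  refine continuous_pi fun l => ?_
  exact ((agg.continuous_compressor l _).comp continuous_fst).matrix_mul
    ((continuous_apply (agg.block l)).comp continuous_snd)

theorem tendsto_update {κ : Type*} {F : Filter κ} {u : κ → Blocks M Q} {X : Blocks M Q}
    {w : κ → Blocks (agg.rows M Q) Q} {W : Blocks (agg.rows M Q) Q} (hu : Tendsto u F (𝓝 X))
    (hw : Tendsto w F (𝓝 W)) :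
    Tendsto (fun i => agg.update (u i) (w i)) F (𝓝 (agg.update X W)) := by
  refine tendsto_pi_nhds.2 fun l => ?_
  have h1 := ((agg.continuous_compressor l (agg.block l)).tendsto X).comp hu
  have h2 := tendsto_pi_nhds.1 hw (agg.block l)
  exact tendsto_matrix_mul h1 h2

/-- The coefficients of the filters `U` with respect to the branchwise generators `G`. -/
def coefficients (G U : Blocks M Q) : Blocks (agg.rows M Q) Q :=
  agg.localVariable (U agg.q) fun n => ∑ l with agg.block l = some n, (G l)ᵀ * U l

theorem continuous_coefficients :
    Continuous fun p : Blocks M Q × Blocks M Q => agg.coefficients p.1 p.2 := by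
  refine continuous_pi fun n => ?_
  rcases n with _ | n
  · exact (continuous_apply agg.q).comp continuous_snd
  · refine continuous_finsetSum _ fun l _ => ?_
    exact ((continuous_apply l).comp continuous_fst).matrix_transpose.matrix_mul
      ((continuous_apply l).comp continuous_snd)

theorem tendsto_coefficients {κ : Type*} {F : Filter κ} {u w : κ → Blocks M Q} {X W : Blocks M Q}
    (hu : Tendsto u F (𝓝 X)) (hw : Tendsto w F (𝓝 W)) :
    Tendsto (fun i => agg.coefficients (u i) (w i)) F (𝓝 (agg.coefficients X W)) := by
  have h := agg.continuous_coefficients.tendsto (X, W)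
  exact Tendsto.comp h (hu.prodMk_nhds hw)

end Aggregation

/-- Gram-Schmidt: the columns of `Z` are spanned by linear combinations of them that are
orthonormal or zero. -/
theorem exists_orthonormal_columns {m : Type*} [Fintype m] (Z : Matrix m (Fin Q) ℝ) :
    ∃ S : Matrix (Fin Q) (Fin Q) ℝ, (∀ i c, |(Z * S) i c| ≤ 1) ∧
      (Z * S) * ((Z * S)ᵀ * Z) = Z := by
  let f : Fin Q → EuclideanSpace ℝ m := fun c => WithLp.toLp 2 fun i => Z i c
  -- Dependent columns yield the zero vector, so no rank condition is needed and the orthogonal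
  -- expansion still reproduces the span.
  let g := InnerProductSpace.gramSchmidtNormed ℝ f
  have hspan : Submodule.span ℝ (Set.range g) = Submodule.span ℝ (Set.range f) := by
    rw [InnerProductSpace.span_gramSchmidtNormed_range, InnerProductSpace.span_gramSchmidt]
  have hS : ∀ c, ∃ s : Fin Q → ℝ, ∑ j, s j • f j = g c := fun c =>
    (Submodule.mem_span_range_iff_exists_fun ℝ).1 (hspan ▸ Submodule.subset_span ⟨c, rfl⟩)
  choose s hs using hS
  have hg : ∀ i c, (Z * Matrix.of fun j c => s c j) i c = g c i := by
    intro i c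
    rw [← hs c]
    simp [Matrix.mul_apply, f, mul_comm]
  have hnorm : ∀ c, ‖g c‖ = 1 ∨ g c = 0 := by
    intro c
    by_cases h : g c = 0
    · exact Or.inr h
    · exact Or.inl (InnerProductSpace.gramSchmidtNormed_unit_length' h)
  have horth : ∀ c c', c ≠ c' → inner ℝ (g c) (g c') = 0 := by
    intro c c' h
    simp only [g, InnerProductSpace.gramSchmidtNormed, inner_smul_left, inner_smul_right,
      InnerProductSpace.gramSchmidt_orthogonal ℝ f h, mul_zero]
  have hrepr : ∀ x ∈ Submodule.span ℝ (Set.range g), ∑ j, inner ℝ (g j) x • g j = x := by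
    intro x hx
    induction hx using Submodule.span_induction with
    | mem x hx =>
      obtain ⟨c, rfl⟩ := hx
      rw [Finset.sum_eq_single c (fun j _ hj => by rw [horth j c hj, zero_smul]) (by simp)]
      rcases hnorm c with h | h
      · rw [real_inner_self_eq_norm_sq, h]
        simp
      · simp [h]
    | zero => simp
    | add x y _ _ hx hy => simp only [inner_add_right, add_smul, Finset.sum_add_distrib, hx, hy]
    | smul a x _ hx => simp only [inner_smul_right, mul_smul, ← Finset.smul_sum, hx]
  refine ⟨Matrix.of fun j c => s c j, fun i c => ?_, ?_⟩
  · rw [hg]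
    refine (PiLp.norm_apply_le (g c) i).trans ?_
    rcases hnorm c with h | h <;> simp [h]
  · ext i c
    have h := hrepr (f c) (hspan ▸ Submodule.subset_span ⟨c, rfl⟩)
    have h' := congrArg (fun x : EuclideanSpace ℝ m => x i) h
    have hf : f c i = Z i c := rfl
    rw [← hf, ← h', Matrix.mul_apply]
    simp only [hg, Matrix.mul_apply, Matrix.transpose_apply, WithLp.ofLp_sum, Finset.sum_apply,
      PiLp.smul_apply, smul_eq_mul, PiLp.inner_apply, RCLike.inner_apply, conj_trivial]
    refine Finset.sum_congr rfl fun j _ => ?_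
    rw [mul_comm]
    congr 1
    refine Finset.sum_congr rfl fun k _ => ?_
    rw [mul_comm]

/-- Every filter can be normalized branchwise, with the same updates and bounded entries. -/
theorem Aggregation.exists_normalization (X : Blocks M Q) :
    ∃ S : Blocks (agg.rows M Q) Q, agg.update X S agg.q = X agg.q ∧
      (∀ l, l ≠ agg.q → ∀ i c, |agg.update X S l i c| ≤ 1) ∧
      ∀ W, agg.update (agg.update X S) (agg.coefficients (agg.update X S) (agg.update X W)) =
        agg.update X W := by
  classical
  -- All nodes of a branch are stacked, with zeros outside it, because the whole branch shares a
  -- single right factor.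
  let Z : {n // n ∈ agg.nbr} → Matrix (Σ l, Fin (M l)) (Fin Q) ℝ := fun n =>
    Matrix.of fun p c => if agg.block p.1 = some n then X p.1 p.2 c else 0
  choose S hS1 hS2 using fun n => exists_orthonormal_columns (Z n)
  have hZ : ∀ l n, agg.block l = some n → ∀ i c, (Z n * S n) ⟨l, i⟩ c = (X l * S n) i c := by
    intro l n hl i c
    simp [Matrix.mul_apply, Z, hl]
  let W0 := agg.localVariable (X agg.q) S
  have hG : ∀ l n, agg.block l = some n → agg.update X W0 l = X l * S n := fun l n hl =>
    agg.update_of_block X W0 hl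
  -- The identity `(Z S)(Z S)ᵀ Z = Z`, read off on the rows of node `l`.
  have key : ∀ l n, agg.block l = some n →
      X l * S n * ∑ l' with agg.block l' = some n, (X l' * S n)ᵀ * X l' = X l := by
    intro l n hl
    ext i c
    have h := congrFun (congrFun (hS2 n) ⟨l, i⟩) c
    have hr : Z n ⟨l, i⟩ c = X l i c := by simp [Z, hl]
    rw [hr, Matrix.mul_apply] at h
    rw [Matrix.mul_apply, ← h]
    refine Finset.sum_congr rfl fun j _ => ?_
    suffices hj : (∑ l' with agg.block l' = some n, (X l' * S n)ᵀ * X l') j c =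
        ((Z n * S n)ᵀ * Z n) j c by rw [hZ l n hl, hj]
    rw [Matrix.sum_apply, Matrix.mul_apply, Fintype.sum_sigma, Finset.sum_filter]
    refine Finset.sum_congr rfl fun l' _ => ?_
    split_ifs with hl'
    · rw [Matrix.mul_apply]
      refine Finset.sum_congr rfl fun i' _ => ?_
      rw [Matrix.transpose_apply, Matrix.transpose_apply, hZ l' n hl']
      simp [Z, hl']
    · symm
      refine Finset.sum_eq_zero fun i' _ => ?_
      simp [Z, hl']
  refine ⟨W0, agg.update_self X W0, fun l hl i c => ?_, fun W => ?_⟩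
  · rcases hb : agg.block l with _ | n
    · exact absurd (agg.block_eq_none.1 hb) hl
    · rw [hG l n hb, ← hZ l n hb]
      exact hS1 n _ _
  · funext l
    rcases hl : agg.block l with _ | n
    · obtain rfl := agg.block_eq_none.1 hl
      rw [agg.update_self]
      rfl
    · rw [agg.update_of_block _ _ hl, hG l n hl, agg.update_of_block X W hl]
      have hc : agg.coefficients (agg.update X W0) (agg.update X W) (some n) =
          (∑ l' with agg.block l' = some n, (X l' * S n)ᵀ * X l') *
            (W (some n) : Matrix (Fin Q) (Fin Q) ℝ) := by
        rw [Matrix.sum_mul]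
        refine Finset.sum_congr rfl fun l' hl' => ?_
        have hl' := (Finset.mem_filter.1 hl').2
        rw [hG l' n hl', agg.update_of_block X W hl']
        exact (Matrix.mul_assoc _ _ _).symm
      rw [hc]
      refine (Matrix.mul_assoc (X l * S n) _ (W (some n) : Matrix (Fin Q) (Fin Q) ℝ)).symm.trans ?_
      rw [key l n hl]

theorem exists_eq_mul_of_columnSpace_le {X Y : Blocks M Q} (h : columnSpace X ≤ columnSpace Y) :
    ∃ R : Matrix (Fin Q) (Fin Q) ℝ, ∀ l, X l = Y l * R := by
  have hs : ∀ c : Fin Q, ∃ s : Fin Q → ℝ,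
      ∑ j, s j • (fun (l : V) (i : Fin (M l)) => Y l i j) = fun l i => X l i c := fun c =>
    (Submodule.mem_span_range_iff_exists_fun ℝ).1 (h (Submodule.subset_span ⟨c, rfl⟩))
  choose s hs using hs
  refine ⟨Matrix.of fun j c => s c j, fun l => ?_⟩
  ext i c
  have := congrFun (congrFun (hs c) l) i
  simp only [Finset.sum_apply, Pi.smul_apply, smul_eq_mul] at this
  rw [← this, Matrix.mul_apply]
  simp [mul_comm]

/-- Finiteness lets an ultrafilter single out one aggregation for each shift of the iteration index.
-/
instance : Finite (Aggregation V) := by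
  classical
  refine Finite.of_injective (β := V × Finset V × (V → Option V))
    (fun a => (a.q, a.nbr, fun l => if h : l ≠ a.q then some (a.branch l h : V) else none)) ?_
  rintro ⟨q, nbr, br⟩ ⟨q', nbr', br'⟩ h
  simp only [Prod.mk.injEq] at h
  obtain ⟨rfl, rfl, h⟩ := h
  congr
  funext l hl
  have := congrFun h l
  simp only [dif_pos hl, Option.some.injEq] at this
  exact Subtype.ext this

end Update

instance {m n : ℕ} : FirstCountableTopology (Matrix (Fin m) (Fin n) ℝ) :=
  inferInstanceAs (FirstCountableTopology (Fin m → Fin n → ℝ))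

/-- Inner semicontinuity is stated for sequences, but it is needed along an ultrafilter. First
countability converts it: otherwise some sequence of data would stay away from `N`. -/
theorem SetValuedContinuousOn.eventually_inter_nonempty {α β : Type*} [TopologicalSpace α]
    [FirstCountableTopology α] [TopologicalSpace β] {F : α → Set β} {s : Set α}
    (h : SetValuedContinuousOn F s) {x : α} (hx : x ∈ s) {u : β} (hu : u ∈ F x) {N : Set β}
    (hN : N ∈ 𝓝 u) : ∀ᶠ x' in 𝓝[s] x, (F x' ∩ N).Nonempty := by
  by_contra hcon
  rw [not_eventually] at hcon
  obtain ⟨xs, hxs, hbad⟩ := exists_seq_forall_of_frequently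
    (hcon.and_eventually self_mem_nhdsWithin)
  obtain ⟨us, hus, hlim⟩ := (h x hx xs (fun t => (hbad t).2)
    (hxs.mono_right nhdsWithin_le_nhds)).2 u hu
  obtain ⟨t, ht⟩ := (hlim.eventually hN).exists
  exact (hbad t).1 ⟨us t, hus t, ht⟩

/-! ### Local problems and the limit of one iteration -/

section Local

variable {V : Type*} [Fintype V] [DecidableEq V]
variable {H : Type*} [NormedAddCommGroup H] [NormedSpace ℝ H]
variable {P : Functions V H} {M : V → ℕ} (dat : P.GlobalData M) (agg : Aggregation V)

namespace Functions.GlobalData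

/-- Compressing the data and then filtering equals filtering with the product of compressor and
local variable. With `objective_localData`, this removes the local data from the rest of the
argument. -/
theorem mem_feasibleSet_localData {X : Blocks M P.Q} {W : Blocks (agg.rows M P.Q) P.Q} :
    W ∈ P.feasibleSet (dat.localData agg X).con ↔ agg.update X W ∈ dat.feasible := by
  simp only [feasible, feasibleSet, localData, central, Aggregation.update, Set.mem_ofPred_eq,
    filterSignal_mul, Matrix.transpose_mul, Matrix.mul_assoc]

theorem objective_localData (X : Blocks M P.Q) (W : Blocks (agg.rows M P.Q) P.Q) :
    P.objective (dat.localData agg X) W = P.objective dat.central (agg.update X W) := by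
  have h1 : P.output (dat.localData agg X) W = P.output dat.central (agg.update X W) := by
    simp only [output, localData, central, Aggregation.update, filterSignal_sum,
      ← filterSignal_mul]
    exact sum_fiber_apply agg.block fun l n => filterSignal (agg.compressor X l n * W n) (dat.y l)
  have h2 : P.outputB (dat.localData agg X) W = P.outputB dat.central (agg.update X W) := by
    simp only [outputB, localData, central, Aggregation.update, Matrix.mul_sum,
      Matrix.transpose_mul, Matrix.mul_assoc]
    exact sum_fiber_apply agg.block
      fun l n => (W n)ᵀ * ((agg.compressor X l n)ᵀ * dat.B l)
  simp only [objective, smoothPart, h1, h2]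
  simp only [regularizer, localData, central, Aggregation.update, Matrix.transpose_mul,
    Matrix.mul_assoc]

theorem isSolution_localData {X : Blocks M P.Q} {W : Blocks (agg.rows M P.Q) P.Q} :
    P.IsSolution (dat.localData agg X) W ↔ agg.update X W ∈ dat.feasible ∧
      ∀ W', agg.update X W' ∈ dat.feasible →
        P.objective dat.central (agg.update X W) ≤ P.objective dat.central (agg.update X W') := by
  simp only [IsSolution, mem_feasibleSet_localData, objective_localData]

theorem Step.mem_feasible {X X' : Blocks M P.Q} (h : dat.Step agg X X') : X' ∈ dat.feasible := by
  obtain ⟨W, hW, rfl⟩ := h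
  exact ((dat.isSolution_localData agg).1 hW).1

theorem Step.objective_le {X X' : Blocks M P.Q} (h : dat.Step agg X X')
    (W : Blocks (agg.rows M P.Q) P.Q) (hW : agg.update X W ∈ dat.feasible) :
    P.objective dat.central X' ≤ P.objective dat.central (agg.update X W) := by
  obtain ⟨W', hW', rfl⟩ := h
  exact ((dat.isSolution_localData agg).1 hW').2 W hW

theorem continuous_con : Continuous fun X : Blocks M P.Q => (dat.localData agg X).con := by
  refine Continuous.prodMk (continuous_pi fun l => ?_) (continuous_pi fun l => continuous_pi fun j => ?_)
  · exact (continuous_filterSignal (dat.y l)).comp (agg.continuous_compressor l _)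
  · exact (agg.continuous_compressor l _).matrix_transpose.matrix_mul continuous_const

/-- The limit of one iteration: the limits before and after the update have the same column space,
and the limit before the update is optimal among its updates. -/
theorem limit_step (hsim : dat.SimilarSolutions agg) (hfeas : dat.FeasibleSetContinuity agg)
    (hL : ContinuousOn (P.objective dat.central) dat.feasible) {κ : Type*} (𝒰 : Ultrafilter κ)
    {u v : κ → Blocks M P.Q} {Xb Yb : Blocks M P.Q}
    (hu : Tendsto u 𝒰 (𝓝 Xb)) (hv : Tendsto v 𝒰 (𝓝 Yb))
    (huF : ∀ᶠ i in (𝒰 : Filter κ), u i ∈ dat.feasible)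
    (hXb : Xb ∈ dat.feasible) (hYb : Yb ∈ dat.feasible)
    (hstep : ∀ᶠ i in (𝒰 : Filter κ), dat.Step agg (u i) (v i))
    (heq : P.objective dat.central Xb = P.objective dat.central Yb) :
    columnSpace Xb = columnSpace Yb ∧ ∀ W, agg.update Xb W ∈ dat.feasible →
      P.objective dat.central Xb ≤ P.objective dat.central (agg.update Xb W) := by
  choose S hSq hSb hSc using fun i => agg.exists_normalization (u i)
  let G : κ → Blocks M P.Q := fun i => agg.update (u i) (S i)
  -- The block of the updating node is untouched by the normalization and converges with `u`; all
  -- other blocks lie in a unit ball.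
  have hG : ∃ Gb, Tendsto G 𝒰 (𝓝 Gb) := by
    have hl : ∀ l, ∃ g, Tendsto (fun i => G i l) 𝒰 (𝓝 g) := by
      intro l
      by_cases hl : l = agg.q
      · subst hl
        refine ⟨Xb agg.q, ?_⟩
        simp only [G, hSq]
        exact ((continuous_apply agg.q).tendsto Xb).comp hu
      · have hK : IsCompact (Metric.closedBall (0 : Matrix (Fin (M l)) (Fin P.Q) ℝ) 1) :=
          isCompact_closedBall _ _
        obtain ⟨g, -, hg⟩ := hK.ultrafilter_le_nhds (𝒰.map fun i => G i l) <| by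
          refine le_principal_iff.2 (mem_map.2 (univ_mem' fun i => ?_))
          change G i l ∈ Metric.closedBall _ _
          rw [mem_closedBall_zero_iff, Matrix.norm_le_iff zero_le_one]
          exact fun r c => hSb i l hl r c
        exact ⟨g, hg⟩
    choose g hg using hl
    exact ⟨g, tendsto_pi_nhds.2 hg⟩
  obtain ⟨Gb, hGb⟩ := hG
  -- Coefficients with respect to the generators depend continuously on generators and filter, so
  -- representability survives the limit.
  have hlim : ∀ {w : κ → Blocks M P.Q} {Z : Blocks M P.Q}, Tendsto w 𝒰 (𝓝 Z) →
      (∀ᶠ i in (𝒰 : Filter κ), ∃ W, w i = agg.update (u i) W) →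
      agg.update Gb (agg.coefficients Gb Z) = Z := by
    intro w Z hw hr
    have h1 : Tendsto (fun i => agg.coefficients (G i) (w i)) 𝒰 (𝓝 (agg.coefficients Gb Z)) :=
      agg.tendsto_coefficients hGb hw
    have h2 : Tendsto (fun i => agg.update (G i) (agg.coefficients (G i) (w i))) 𝒰
        (𝓝 (agg.update Gb (agg.coefficients Gb Z))) :=
      agg.tendsto_update hGb h1
    refine tendsto_nhds_unique h2 (hw.congr' ?_)
    filter_upwards [hr] with i ⟨W, hW⟩
    rw [hW]
    exact (hSc i W).symm
  have hid : ∀ i, ∃ W, u i = agg.update (u i) W := fun i =>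
    ⟨agg.localVariable (u i agg.q) fun _ => 1, by
      rw [agg.update_localVariable_one, Function.update_eq_self]⟩
  have hX := hlim hu (Eventually.of_forall hid)
  have hY := hlim hv (hstep.mono fun i ⟨W, _, hW⟩ => ⟨W, hW⟩)
  -- A competitor at `Gb` is approximated by feasible competitors at `G i`. These are also updates
  -- of `u i`, so `v i` is at least as good as each of them.
  have hmin : ∀ W, agg.update Gb W ∈ dat.feasible →
      P.objective dat.central Yb ≤ P.objective dat.central (agg.update Gb W) := by
    intro W hW
    refine le_of_forall_pos_lt_add fun ε hε => ?_
    have hnhds : ∀ᶠ p in 𝓝 (Gb, W), agg.update p.1 p.2 ∈ dat.feasible →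
        P.objective dat.central (agg.update p.1 p.2) <
          P.objective dat.central (agg.update Gb W) + ε / 2 := by
      have h := (hL _ hW).eventually (gt_mem_nhds (lt_add_of_pos_right
        (P.objective dat.central (agg.update Gb W)) (half_pos hε)))
      rw [eventually_nhdsWithin_iff] at h
      exact (agg.continuous_update.tendsto (Gb, W)).eventually h
    rw [nhds_prod_eq] at hnhds
    obtain ⟨p, hp, N, hN, hpN⟩ := eventually_prod_iff.1 hnhds
    have hmem : (dat.localData agg Gb).con ∈ {c : P.ConstraintData (agg.rows M P.Q) agg.block |
        (∃ X : Blocks M P.Q, c = (dat.localData agg X).con) ∧ (P.feasibleSet c).Nonempty} :=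
      ⟨⟨Gb, rfl⟩, W, (dat.mem_feasibleSet_localData agg).2 hW⟩
    have hinner := hfeas.eventually_inter_nonempty hmem
      ((dat.mem_feasibleSet_localData agg).2 hW) hN
    have hcon : Tendsto (fun i => (dat.localData agg (G i)).con) 𝒰
        (𝓝[{c : P.ConstraintData (agg.rows M P.Q) agg.block |
        (∃ X : Blocks M P.Q, c = (dat.localData agg X).con) ∧ (P.feasibleSet c).Nonempty}]
          (dat.localData agg Gb).con) := by
      refine tendsto_nhdsWithin_iff.2 ⟨((dat.continuous_con agg).tendsto Gb).comp hGb, ?_⟩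
      filter_upwards [huF] with i hi
      -- The local problem at `G i` is feasible because `u i` itself is an update of `G i`.
      refine ⟨⟨G i, rfl⟩, agg.coefficients (G i) (u i), (dat.mem_feasibleSet_localData agg).2 ?_⟩
      obtain ⟨W', hW'⟩ := hid i
      have h := hSc i W'
      rw [← hW'] at h
      change agg.update (G i) (agg.coefficients (G i) (u i)) ∈ _
      rw [h]
      exact hi
    have hvF : ∀ᶠ i in (𝒰 : Filter κ), v i ∈ dat.feasible := hstep.mono fun i hi => hi.mem_feasible
    have hvL : Tendsto (fun i => P.objective dat.central (v i)) 𝒰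
        (𝓝 (P.objective dat.central Yb)) :=
      (hL _ hYb).tendsto.comp (tendsto_nhdsWithin_iff.2 ⟨hv, hvF⟩)
    obtain ⟨i, hi1, hi2, hi3, hi4⟩ := ((hcon.eventually hinner).and ((hGb.eventually hp).and
      (hstep.and (hvL.eventually (lt_mem_nhds
        (sub_lt_self (P.objective dat.central Yb) (half_pos hε))))))).exists
    obtain ⟨W', hW'F, hW'N⟩ := hi1
    have hF := (dat.mem_feasibleSet_localData agg).1 hW'F
    have h1 := hpN hi2 hW'N hF
    obtain ⟨W'', hW''⟩ := agg.exists_update_update (u i) (S i) W'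
    have h2 := hi3.objective_le dat agg W'' (hW'' ▸ hF)
    rw [← hW''] at h2
    change _ ≤ P.objective dat.central (agg.update (G i) W') at h2
    dsimp only at h1
    linarith
  constructor
  · have hsolX : P.IsSolution (dat.localData agg Gb) (agg.coefficients Gb Xb) := by
      rw [isSolution_localData, hX, heq]
      exact ⟨hXb, hmin⟩
    have hsolY : P.IsSolution (dat.localData agg Gb) (agg.coefficients Gb Yb) := by
      rw [isSolution_localData, hY]
      exact ⟨hYb, hmin⟩
    have := hsim _ _ _ hsolX hsolY
    rwa [hX, hY] at this
  · intro W hW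
    obtain ⟨W', hW'⟩ := agg.exists_update_update Gb (agg.coefficients Gb Xb) W
    rw [hX] at hW'
    rw [hW'] at hW ⊢
    rw [heq]
    exact hmin W' hW

end Functions.GlobalData

end Local

/-! ### A sum rule by quadratic decoupling -/

section SumRule

variable {E : Type*} [NormedAddCommGroup E] [InnerProductSpace ℝ E]

/-- A local minimizer in the interior of a ball of a convex function plus a quadratic penalty
yields a subgradient of the convex function. -/
theorem subgradient_of_penalty_min {G : E → ℝ} (hG : ConvexOn ℝ Set.univ G) {ρ : ℝ} {y z : E}
    (hmin : ∀ᶠ u in 𝓝 z, G z + ρ / 2 * ‖y - z‖ ^ 2 ≤ G u + ρ / 2 * ‖y - u‖ ^ 2) (u : E) :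
    G z + inner ℝ (ρ • (y - z)) (u - z) ≤ G u := by
  have hlim : Tendsto (fun τ : ℝ => z + τ • (u - z)) (𝓝[>] 0) (𝓝 z) := by
    have : Continuous fun τ : ℝ => z + τ • (u - z) := by fun_prop
    simpa using (this.tendsto 0).mono_left nhdsWithin_le_nhds
  have hlim' : Tendsto (fun τ : ℝ => G u + ρ / 2 * (τ * ‖u - z‖ ^ 2)) (𝓝[>] 0) (𝓝 (G u)) := by
    have : Continuous fun τ : ℝ => G u + ρ / 2 * (τ * ‖u - z‖ ^ 2) := by fun_prop
    simpa using (this.tendsto 0).mono_left nhdsWithin_le_nhds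
  -- Minimality is tested on the segment from `z` to `u`. After division by `τ`, the only error is
  -- `ρ / 2 * (τ * ‖u - z‖ ^ 2)`.
  refine ge_of_tendsto hlim' ?_
  filter_upwards [hlim.eventually hmin, Ioo_mem_nhdsGT (zero_lt_one' ℝ)] with τ h ⟨h0, h1⟩
  have hconv := hG.2 (Set.mem_univ z) (Set.mem_univ u) (sub_nonneg.2 h1.le) h0.le (by ring)
  have hz : (1 - τ) • z + τ • u = z + τ • (u - z) := by
    rw [smul_sub, sub_smul, one_smul]; abel
  rw [hz, smul_eq_mul, smul_eq_mul] at hconv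
  have hn : ‖y - (z + τ • (u - z))‖ ^ 2 =
      ‖y - z‖ ^ 2 - 2 * (τ * inner ℝ (y - z) (u - z)) + τ ^ 2 * ‖u - z‖ ^ 2 := by
    rw [← sub_sub, norm_sub_sq_real, inner_smul_right, norm_smul, mul_pow, Real.norm_eq_abs, sq_abs]
  rw [hn] at h
  rw [real_inner_smul_left]
  refine le_of_mul_le_mul_left ?_ h0
  linarith

/-- A minimizer on `C` of a linear function plus a quadratic penalty yields a regular normal. -/
theorem regular_normal_of_penalty_min {C : Set E} {v : E} {ρ : ℝ} (hρ : 0 < ρ) {y z : E}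
    (hmin : ∀ᶠ u in 𝓝[C] y,
      inner ℝ v y + ρ / 2 * ‖y - z‖ ^ 2 ≤ inner ℝ v u + ρ / 2 * ‖u - z‖ ^ 2)
    {ε : ℝ} (hε : 0 < ε) :
    ∀ᶠ u in 𝓝[C] y, inner ℝ (-(v + ρ • (y - z))) (u - y) ≤ ε * ‖u - y‖ := by
  -- In this ball the quadratic remainder `ρ / 2 * ‖u - y‖ ^ 2` is at most `ε * ‖u - y‖`.
  have hball : ∀ᶠ u in 𝓝[C] y, u ∈ Metric.ball y (2 * ε / ρ) :=
    mem_nhdsWithin_of_mem_nhds (Metric.ball_mem_nhds _ (by positivity))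
  filter_upwards [hmin, hball] with u h hu
  rw [mem_ball_iff_norm, lt_div_iff₀ hρ] at hu
  have hn : ‖u - z‖ ^ 2 = ‖u - y‖ ^ 2 + 2 * inner ℝ (y - z) (u - y) + ‖y - z‖ ^ 2 := by
    rw [← sub_add_sub_cancel u y z, norm_add_sq_real, real_inner_comm]
  rw [hn] at h
  rw [inner_neg_left, inner_add_left, real_inner_smul_left, inner_sub_right v]
  nlinarith [norm_nonneg (u - y)]

variable [FiniteDimensional ℝ E]

/-- Fuzzy sum rule for a linear function, a Lipschitz convex function and a closed set. -/
theorem exists_approximate_multipliers {C : Set E} (hC : IsClosed C) {x v : E} (hx : x ∈ C)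
    {g : E → ℝ} (hg : ConvexOn ℝ Set.univ g) {ε r K : ℝ} (hε : 0 < ε) (hε1 : ε ≤ 1) (hr : 0 < r)
    (hK : 0 ≤ K)
    (hLip : ∀ a ∈ Metric.closedBall x r, ∀ b ∈ Metric.closedBall x r, g a - g b ≤ K * ‖a - b‖)
    (hmin : ∀ y ∈ C, y ∈ Metric.closedBall x r →
      -(ε * ‖y - x‖) ≤ inner ℝ v (y - x) + g y - g x) :
    ∃ y ∈ C, ∃ z S : E, ‖y - x‖ ≤ ε ∧ ‖z - x‖ ≤ ε ∧ ‖S‖ ≤ 2 * (K + 2) ∧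
      (∀ u, g z - 2 * ε * ‖u - z‖ + inner ℝ S (u - z) ≤ g u) ∧
      ∀ ε' : ℝ, 0 < ε' → ∀ᶠ u in 𝓝[C] y, inner ℝ (-(v + S)) (u - y) ≤ ε' * ‖u - y‖ := by
  have hgc : Continuous g := hg.locallyLipschitz.continuous
  set A := K + 2 with hA
  set m := min ε r with hm
  have hm0 : 0 < m := lt_min hε hr
  have hA2 : 2 ≤ A := by linarith
  -- Chosen so that `‖y - z‖ ≤ 2A/ρ` and `‖y - x‖ ≤ A‖y - z‖/ε` give at most `m/8` and `m/4`, which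
  -- keeps both points inside the ball.
  set ρ := 8 * A ^ 2 / (ε * m) with hρdef
  have hρ : 0 < ρ := by positivity
  have hρm : ρ * (ε * m) = 8 * A ^ 2 := div_mul_cancel₀ _ (by positivity)
  -- The constraint acts on `y`, the convex function on `z`, and the penalty couples them. The
  -- weight `2 * ε` exceeds the slack `ε` in `hmin` and so forces the minimizer close to `x`.
  let Φ : E × E → ℝ := fun p =>
    inner ℝ v (p.1 - x) + (g p.2 + 2 * ε * ‖p.2 - x‖) + ρ / 2 * ‖p.1 - p.2‖ ^ 2
  have hΦ : Continuous Φ := by fun_prop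
  have hcomp : IsCompact ((C ∩ Metric.closedBall x r) ×ˢ Metric.closedBall x r) :=
    ((isCompact_closedBall x r).inter_left hC).prod (isCompact_closedBall x r)
  have hxr : x ∈ Metric.closedBall x r := Metric.mem_closedBall_self hr.le
  obtain ⟨⟨y, z⟩, ⟨⟨hyC, hyr⟩, hzr⟩, hopt⟩ :=
    hcomp.exists_isMinOn ⟨(x, x), ⟨hx, hxr⟩, hxr⟩ hΦ.continuousOn
  dsimp only at hyC hyr hzr
  have hopt' : ∀ y' ∈ C, y' ∈ Metric.closedBall x r → ∀ z' ∈ Metric.closedBall x r,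
      Φ (y, z) ≤ Φ (y', z') := fun y' h1 h2 z' h3 => hopt (show (y', z') ∈ _ from ⟨⟨h1, h2⟩, h3⟩)
  -- Comparison with `(y, y)` bounds `ρ * ‖y - z‖`, the norm of the multiplier, independently of
  -- `ε`; comparison with `(x, x)` localizes `y`.
  have h1 := hopt' y hyC hyr y hyr
  have h2 := hopt' x hx hxr x hxr
  simp only [Φ, sub_self, norm_zero, inner_zero_right] at h1 h2
  have hL := hLip y hyr z hzr
  have htri : ‖y - x‖ ≤ ‖y - z‖ + ‖z - x‖ := norm_sub_le_norm_sub_add_norm_sub y z x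
  have hd0 : 0 ≤ ‖y - z‖ := norm_nonneg _
  have hAd : (K + 2 * ε) * ‖y - z‖ ≤ A * ‖y - z‖ :=
    mul_le_mul_of_nonneg_right (by linarith) hd0
  have hρd : ρ * ‖y - z‖ ≤ 2 * A := by
    have h3 : ρ / 2 * ‖y - z‖ ^ 2 ≤ A * ‖y - z‖ := by nlinarith
    rcases hd0.eq_or_lt with h | h
    · rw [← h]; linarith
    · refine le_of_mul_le_mul_right ?_ h
      linarith
  have hdist : ε * ‖y - x‖ ≤ A * ‖y - z‖ := by
    have h3 := hmin y hyC hyr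
    have h4 : 0 ≤ ρ / 2 * ‖y - z‖ ^ 2 := by positivity
    nlinarith
  have hd : ‖y - z‖ ≤ m / 8 := by
    refine le_of_mul_le_mul_left (hρd.trans ?_) hρ
    have h5 : ρ * (ε * m) ≤ ρ * m := by
      refine mul_le_mul_of_nonneg_left ?_ hρ.le
      nlinarith
    nlinarith
  have hy : ‖y - x‖ ≤ m / 4 := by
    refine le_of_mul_le_mul_left ?_ (mul_pos hρ hε)
    have h6 : ρ * (ε * ‖y - x‖) ≤ ρ * (A * ‖y - z‖) := mul_le_mul_of_nonneg_left hdist hρ.le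
    have h7 : A * (ρ * ‖y - z‖) ≤ A * (2 * A) := mul_le_mul_of_nonneg_left hρd (by linarith)
    nlinarith
  have hz : ‖z - x‖ ≤ m / 2 := by
    have : ‖z - x‖ ≤ ‖z - y‖ + ‖y - x‖ := norm_sub_le_norm_sub_add_norm_sub z y x
    rw [norm_sub_rev z y] at this
    linarith
  have hmε : m ≤ ε := min_le_left _ _
  have hmr : m ≤ r := min_le_right _ _
  have hnear : ∀ w : E, ‖w - x‖ ≤ m / 2 → Metric.closedBall x r ∈ 𝓝 w := by
    intro w hw
    refine mem_of_superset (Metric.isOpen_ball.mem_nhds ?_) Metric.ball_subset_closedBall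
    rw [mem_ball_iff_norm]
    linarith
  refine ⟨y, hyC, z, ρ • (y - z), by linarith, by linarith, ?_, fun u => ?_, fun ε' hε' => ?_⟩
  · rwa [norm_smul, Real.norm_of_nonneg hρ.le]
  · have hconv : ConvexOn ℝ Set.univ fun w => g w + 2 * ε * ‖w - x‖ := by
      refine hg.add ?_
      have := (convexOn_univ_norm (E := E)).translate_left (-x)
      simp only [Set.preimage_univ] at this
      have h8 : ConvexOn ℝ Set.univ fun w : E => ‖w - x‖ := by
        simpa [Function.comp_def, sub_eq_add_neg, add_comm] using this
      simpa using h8.smul (c := 2 * ε) (by positivity)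
    have h9 := subgradient_of_penalty_min hconv (ρ := ρ) (y := y) (z := z) ?_ u
    · have : ‖u - x‖ ≤ ‖u - z‖ + ‖z - x‖ := norm_sub_le_norm_sub_add_norm_sub u z x
      have : 2 * ε * ‖u - x‖ ≤ 2 * ε * (‖u - z‖ + ‖z - x‖) :=
        mul_le_mul_of_nonneg_left this (by positivity)
      linarith
    · filter_upwards [hnear z hz] with w hw
      have := hopt' y hyC hyr w hw
      simp only [Φ] at this
      linarith
  · refine regular_normal_of_penalty_min hρ ?_ hε'
    filter_upwards [self_mem_nhdsWithin,
      mem_nhdsWithin_of_mem_nhds (hnear y (by linarith))] with w hwC hwr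
    have := hopt' w hwC hwr z hzr
    simp only [Φ, inner_sub_right] at this
    linarith

/-- Sum rule: first-order optimality on a closed set for the sum of a linear and a finite convex
function gives a subgradient and a limiting normal. -/
theorem exists_subgradient_limiting_normal {C : Set E} (hC : IsClosed C) {x v : E} (hx : x ∈ C)
    {g : E → ℝ} (hg : ConvexOn ℝ Set.univ g)
    (hmin : ∀ ε : ℝ, 0 < ε → ∀ᶠ y in 𝓝[C] x,
      -(ε * ‖y - x‖) ≤ inner ℝ v (y - x) + g y - g x) :
    ∃ S : E, (∀ u, g x + inner ℝ S (u - x) ≤ g u) ∧ ∃ ys Ns : ℕ → E, (∀ t, ys t ∈ C) ∧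
      (∀ t, ∀ ε : ℝ, 0 < ε → ∀ᶠ u in 𝓝[C] ys t, inner ℝ (Ns t) (u - ys t) ≤ ε * ‖u - ys t‖) ∧
      Tendsto ys atTop (𝓝 x) ∧ Tendsto Ns atTop (𝓝 (-(v + S))) := by
  have hgc : Continuous g := hg.locallyLipschitz.continuous
  -- One Lipschitz constant serves all `ε t`, so the approximate subgradients are bounded and have a
  -- convergent subsequence.
  obtain ⟨K, U, hU, hKU⟩ := hg.locallyLipschitz x
  obtain ⟨r0, hr0, hr0U⟩ := Metric.nhds_basis_closedBall.mem_iff.1 hU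
  let ε : ℕ → ℝ := fun t => 1 / ((t : ℝ) + 1)
  have hεpos : ∀ t, 0 < ε t := fun t => Nat.one_div_pos_of_nat
  have hε0 : Tendsto ε atTop (𝓝 0) := tendsto_one_div_add_atTop_nhds_zero_nat
  have hex : ∀ t, ∃ y ∈ C, ∃ z S : E, ‖y - x‖ ≤ ε t ∧ ‖z - x‖ ≤ ε t ∧ ‖S‖ ≤ 2 * ((K : ℝ) + 2) ∧
      (∀ u, g z - 2 * ε t * ‖u - z‖ + inner ℝ S (u - z) ≤ g u) ∧
      ∀ ε' : ℝ, 0 < ε' → ∀ᶠ u in 𝓝[C] y, inner ℝ (-(v + S)) (u - y) ≤ ε' * ‖u - y‖ := by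
    intro t
    have h := hmin (ε t) (hεpos t)
    rw [eventually_nhdsWithin_iff] at h
    obtain ⟨r1, hr1, hr1'⟩ := Metric.nhds_basis_closedBall.mem_iff.1 h
    refine exists_approximate_multipliers hC hx hg (hεpos t) ?_ (lt_min hr0 hr1) K.2 ?_ ?_
    · refine (div_le_one (by positivity)).2 ?_
      linarith [(Nat.cast_nonneg t : (0 : ℝ) ≤ t)]
    · intro a ha b hb
      have hsub := Metric.closedBall_subset_closedBall (x := x) (min_le_left r0 r1)
      have := hKU.dist_le_mul a (hr0U (hsub ha)) b (hr0U (hsub hb))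
      rw [Real.dist_eq, dist_eq_norm] at this
      exact (le_abs_self _).trans this
    · intro y hyC hy
      exact hr1' (Metric.closedBall_subset_closedBall (min_le_right r0 r1) hy) hyC
  choose ys hysC zs Ss hys hzs hSs hsub hnorm using hex
  have hconv : ∀ w : ℕ → E, (∀ t, ‖w t - x‖ ≤ ε t) → Tendsto w atTop (𝓝 x) := fun w hw =>
    tendsto_iff_norm_sub_tendsto_zero.2 (squeeze_zero (fun _ => norm_nonneg _) hw hε0)
  obtain ⟨S, -, σ, hσ, hS⟩ := tendsto_subseq_of_bounded
    (Metric.isBounded_closedBall (x := (0 : E)) (r := 2 * ((K : ℝ) + 2)))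
    (fun t => mem_closedBall_zero_iff.2 (hSs t))
  refine ⟨S, fun u => ?_, ys ∘ σ, fun t => -(v + Ss (σ t)), fun t => hysC _, fun t => hnorm _,
    (hconv ys hys).comp hσ.tendsto_atTop, (hS.const_add v).neg⟩
  have hz := (hconv zs hzs).comp hσ.tendsto_atTop
  have h1 : Tendsto (fun t => g (zs (σ t)) - 2 * ε (σ t) * ‖u - zs (σ t)‖ +
      inner ℝ (Ss (σ t)) (u - zs (σ t))) atTop
      (𝓝 (g x - 2 * 0 * ‖u - x‖ + inner ℝ S (u - x))) :=
    ((((hgc.tendsto x).comp hz).sub (((hε0.comp hσ.tendsto_atTop).const_mul 2).mul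
      (hz.const_sub u).norm)).add (hS.inner (hz.const_sub u)))
  have h2 := le_of_tendsto' h1 fun t => hsub (σ t) u
  simpa using h2

end SumRule

/-! ### Transfer to the Frobenius geometry -/

section Euclidean

variable {ι : Type*} [Fintype ι] {r : ι → ℕ} {Q : ℕ}

/-- Block matrices as vectors of a Euclidean space. -/
def blocksEquiv (r : ι → ℕ) (Q : ℕ) :
    Blocks r Q ≃L[ℝ] EuclideanSpace ℝ (Σ n, Fin (r n) × Fin Q) where
  toFun X := WithLp.toLp 2 fun p => X p.1 p.2.1 p.2.2
  invFun x n := Matrix.of fun i c => x ⟨n, i, c⟩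
  left_inv X := rfl
  right_inv x := rfl
  map_add' X Y := rfl
  map_smul' a X := rfl
  continuous_toFun := by
    refine (PiLp.continuous_toLp 2 _).comp (continuous_pi fun p => ?_)
    exact (continuous_apply p.2.2).comp ((continuous_apply p.2.1).comp (continuous_apply p.1))
  continuous_invFun := by
    refine continuous_pi fun n => continuous_pi fun i => continuous_pi fun c => ?_
    have h : Continuous fun x : EuclideanSpace ℝ (Σ n, Fin (r n) × Fin Q) => x ⟨n, i, c⟩ := by
      fun_prop
    exact h

theorem inner_blocksEquiv (U W : Blocks r Q) :
    inner ℝ (blocksEquiv r Q U) (blocksEquiv r Q W) = frobInner U W := by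
  simp only [PiLp.inner_apply, RCLike.inner_apply, conj_trivial, frobInner, Matrix.trace,
    Matrix.diag, Matrix.mul_apply, Matrix.transpose_apply]
  rw [Fintype.sum_sigma]
  refine Finset.sum_congr rfl fun n _ => ?_
  rw [Fintype.sum_prod_type, Finset.sum_comm]
  refine Finset.sum_congr rfl fun c _ => Finset.sum_congr rfl fun i _ => ?_
  exact mul_comm _ _

theorem norm_blocksEquiv (U : Blocks r Q) : ‖blocksEquiv r Q U‖ = frobNorm U := by
  rw [frobNorm, ← inner_blocksEquiv, norm_eq_sqrt_real_inner]

/-- `blocksEquiv` is a homeomorphism that carries the Frobenius inner product to the Euclidean one,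
so the sum rule transfers although blocks carry the elementwise norm. -/
theorem exists_subdifferential_normalCone {C : Set (Blocks r Q)} (hC : IsClosed C)
    {X v : Blocks r Q} (hX : X ∈ C) {g : Blocks r Q → ℝ} (hg : ConvexOn ℝ Set.univ g)
    (hmin : ∀ ε : ℝ, 0 < ε → ∀ᶠ U in 𝓝[C] X,
      -(ε * frobNorm (U - X)) ≤ frobInner v (U - X) + g U - g X) :
    ∃ S ∈ subdifferential g X, ∃ N ∈ normalCone C X, v + S + N = 0 := by
  let e := blocksEquiv r Q
  have hmap : ∀ x, x ∈ e.symm ⁻¹' C → Tendsto e.symm (𝓝[e.symm ⁻¹' C] x) (𝓝[C] (e.symm x)) :=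
    fun x _ => e.symm.continuous.continuousWithinAt.tendsto_nhdsWithin fun _ h => h
  have hmap' : ∀ U, Tendsto e (𝓝[C] U) (𝓝[e.symm ⁻¹' C] (e U)) := fun U =>
    e.continuous.continuousWithinAt.tendsto_nhdsWithin fun W hW => by
      simpa only [Set.mem_preimage, e.symm_apply_apply] using hW
  have heX : e X ∈ e.symm ⁻¹' C := by simpa only [Set.mem_preimage, e.symm_apply_apply] using hX
  obtain ⟨S, hS, ys, Ns, hys, hNs, hlimy, hlimN⟩ := exists_subgradient_limiting_normal
    (C := e.symm ⁻¹' C) (x := e X) (v := e v) (g := fun w => g (e.symm w))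
    (hC.preimage e.symm.continuous) heX (hg.comp_linearMap e.symm.toLinearMap) (by
      intro ε hε
      have := (hmap _ heX).eventually ((e.symm_apply_apply X).symm ▸ hmin ε hε)
      filter_upwards [this] with w hw
      rw [← norm_blocksEquiv, ← inner_blocksEquiv] at hw
      simpa [e] using hw)
  refine ⟨e.symm S, fun U => ?_, -(v + e.symm S), ⟨hX, fun t => e.symm (ys t),
    fun t => e.symm (Ns t), hys, fun t => ⟨hys t, fun ε hε => ?_⟩, ?_, ?_⟩, by abel⟩
  · have := hS (e U)
    rw [← inner_blocksEquiv]
    simpa [e] using this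
  · have h1 := (hmap' (e.symm (ys t))).eventually ((e.apply_symm_apply (ys t)).symm ▸ hNs t ε hε)
    filter_upwards [h1] with U hU
    rw [← norm_blocksEquiv, ← inner_blocksEquiv]
    simpa [e] using hU
  · simpa only [e.symm_apply_apply, Function.comp_def] using
      (e.symm.continuous.tendsto (e X)).comp hlimy
  · have := (e.symm.continuous.tendsto (-(e v + S))).comp hlimN
    simpa only [map_neg, map_add, e.symm_apply_apply, Function.comp_def] using this

end Euclidean

/-! ### From blockwise minimality to a joint first-order condition -/

section Gradient

variable {ι : Type*} [Fintype ι] [DecidableEq ι] {r : ι → ℕ} {Q : ℕ}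

theorem sum_single_block (U : Blocks r Q) : ∑ n, Pi.single n (U n) = U :=
  Finset.univ_sum_single U

theorem frobInner_blockGradient (f : Blocks r Q → ℝ) (X U : Blocks r Q) :
    frobInner (blockGradient f X) U = fderiv ℝ f X U := by
  have hU : U = ∑ n, ∑ i, ∑ c, U n i c • (Pi.single n (Matrix.single i c 1) : Blocks r Q) := by
    conv_lhs => rw [← sum_single_block U]
    refine Finset.sum_congr rfl fun n _ => ?_
    conv_lhs => rw [Matrix.matrix_eq_sum_single (U n)]
    have hs : ∀ A : Matrix (Fin (r n)) (Fin Q) ℝ, (Pi.single n A : Blocks r Q) =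
      LinearMap.single ℝ (fun n => Matrix (Fin (r n)) (Fin Q) ℝ) n A := fun _ => rfl
    simp only [hs, map_sum, ← map_smul, Matrix.smul_single, smul_eq_mul, mul_one]
  conv_rhs => rw [hU]
  simp only [map_sum, map_smul, smul_eq_mul, frobInner, Matrix.trace, Matrix.diag, Matrix.mul_apply,
    Matrix.transpose_apply, blockGradient, Matrix.of_apply]
  refine Finset.sum_congr rfl fun n _ => ?_
  rw [Finset.sum_comm]
  exact Finset.sum_congr rfl fun i _ => Finset.sum_congr rfl fun c _ => mul_comm _ _

/-- Blockwise optimality yields linearized optimality in all blocks at once. -/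
theorem linearized_min_of_blockwise_min {f g : Blocks r Q → ℝ} {C : Set (Blocks r Q)}
    {X : Blocks r Q} (hf : DifferentiableAt ℝ f X)
    (hsep : ∀ U, g U - g X = ∑ n, (g (Function.update X n (U n)) - g X))
    (hmin : ∀ U ∈ C, ∀ n,
      f X + g X ≤ f (Function.update X n (U n)) + g (Function.update X n (U n)))
    {ε : ℝ} (hε : 0 < ε) :
    ∀ᶠ U in 𝓝[C] X, -(ε * frobNorm (U - X)) ≤
      frobInner (blockGradient f X) (U - X) + g U - g X := by
  obtain ⟨c, hc, hcb⟩ := (blocksEquiv r Q).symm.toContinuousLinearMap.bound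
  have hnorm : ∀ U : Blocks r Q, ‖U‖ ≤ c * frobNorm U := fun U => by
    have h := hcb (blocksEquiv r Q U)
    rw [norm_blocksEquiv] at h
    exact h
  -- `c` compares the two norms and the cardinality counts the errors to be added; the `+ 1` keeps
  -- `k` positive for empty `ι`.
  let k : ℝ := c * (Fintype.card ι + 1)
  have hk : 0 < k := by positivity
  have hlittle := hf.hasFDerivAt.isLittleO.def (div_pos hε hk)
  have hev : ∀ n, ∀ᶠ U in 𝓝[C] X, f (Function.update X n (U n)) - f X -
      fderiv ℝ f X (Pi.single n ((U - X) n)) ≤ ε / k * ‖U - X‖ := by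
    intro n
    have hcont : Continuous fun U : Blocks r Q => Function.update X n (U n) :=
      continuous_const.update n (continuous_apply n)
    have ht : Tendsto (fun U : Blocks r Q => Function.update X n (U n)) (𝓝[C] X) (𝓝 X) := by
      have := (hcont.tendsto X).mono_left (nhdsWithin_le_nhds (s := C))
      rwa [Function.update_eq_self] at this
    filter_upwards [ht.eventually hlittle] with U hU
    have hs : Function.update X n (U n) - X = Pi.single n ((U - X) n) := by
      funext m
      by_cases h : m = n
      · subst h; simp
      · simp [h]
    rw [hs] at hU
    refine (le_abs_self _).trans (hU.trans ?_)
    refine mul_le_mul_of_nonneg_left ?_ (by positivity)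
    rw [Pi.norm_single]
    exact norm_le_pi_norm (U - X) n
  filter_upwards [eventually_all.2 hev, self_mem_nhdsWithin] with U hU hUC
  have h1 : ∀ n, -(ε / k * ‖U - X‖) ≤ fderiv ℝ f X (Pi.single n ((U - X) n)) +
      (g (Function.update X n (U n)) - g X) := fun n => by
    linarith [hU n, hmin U hUC n]
  -- The derivative is additive over the blocks and `g` is separable, so the sum involves the joint
  -- displacement `U - X`.
  have h2 := Finset.sum_le_sum fun n (_ : n ∈ Finset.univ) => h1 n
  rw [Finset.sum_add_distrib, ← hsep, ← map_sum, sum_single_block, Finset.sum_const,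
    Finset.card_univ, nsmul_eq_mul] at h2
  rw [frobInner_blockGradient]
  have h3 : (Fintype.card ι : ℝ) * (ε / k * ‖U - X‖) ≤ ε * frobNorm (U - X) := by
    have h0 : 0 ≤ frobNorm (U - X) := Real.sqrt_nonneg _
    have h4 : ε / k * ‖U - X‖ ≤ ε / k * (c * frobNorm (U - X)) :=
      mul_le_mul_of_nonneg_left (hnorm _) (by positivity)
    have h5 : (Fintype.card ι + 1 : ℝ) * (ε / k * (c * frobNorm (U - X))) =
        ε * frobNorm (U - X) := by
      simp only [k]
      field_simp
    have h6 : 0 ≤ ε / k * (c * frobNorm (U - X)) := by positivity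
    have h7 := mul_le_mul_of_nonneg_left h4 (Nat.cast_nonneg (α := ℝ) (Fintype.card ι))
    linarith
  linarith

end Gradient

/-! ### Stationarity of the limits -/

section Central

variable {V : Type*} [Fintype V] [DecidableEq V]
variable {H : Type*} [NormedAddCommGroup H] [NormedSpace ℝ H]
variable {P : Functions V H} {M : V → ℕ} (dat : P.GlobalData M)

namespace Functions.GlobalData

theorem mem_feasible {X : Blocks M P.Q} : X ∈ dat.feasible ↔ ∀ k,
    (∀ j, dat.nodeConstraint k (Sum.inl j) (X k) ≤ 0) ∧
      ∀ j, dat.nodeConstraint k (Sum.inr j) (X k) = 0 :=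
  Iff.rfl

theorem update_mem_feasible {X U : Blocks M P.Q} (hX : X ∈ dat.feasible) (hU : U ∈ dat.feasible)
    (k : V) : Function.update X k (U k) ∈ dat.feasible := by
  rw [mem_feasible] at *
  intro l
  by_cases h : l = k
  · subst h
    rw [Function.update_self]
    exact hU l
  · rw [Function.update_of_ne h]
    exact hX l

theorem isClosed_feasible (hsmooth : dat.Smooth) : IsClosed dat.feasible := by
  have hcont : ∀ k j, Continuous fun X : Blocks M P.Q => dat.nodeConstraint k j (X k) := by
    intro k j
    have h1 : Continuous fun X : Blocks M P.Q => filterSignal (X k) (dat.y k) :=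
      (continuous_filterSignal (dat.y k)).comp (continuous_apply k)
    have h2 : Continuous fun X : Blocks M P.Q => (X k)ᵀ * dat.D k j :=
      (continuous_apply k).matrix_transpose.matrix_mul continuous_const
    exact (hsmooth.2 k j).continuous.comp (h1.prodMk h2)
  have : dat.feasible = {X : Blocks M P.Q | ∀ k,
      (∀ j, dat.nodeConstraint k (Sum.inl j) (X k) ≤ 0) ∧
        ∀ j, dat.nodeConstraint k (Sum.inr j) (X k) = 0} := rfl
  rw [this]
  simp only [Set.ofPred_forall, Set.ofPred_and]
  exact isClosed_iInter fun k =>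
    (isClosed_iInter fun j => isClosed_le (hcont k _) continuous_const).inter
      (isClosed_iInter fun j => isClosed_eq (hcont k _) continuous_const)

theorem differentiableAt_smoothPart (hsmooth : dat.Smooth) {X : Blocks M P.Q}
    (hX : X ∈ dat.feasible) : DifferentiableAt ℝ (P.smoothPart dat.central) X := by
  have hφ : DifferentiableAt ℝ (Function.uncurry P.φ)
      (P.output dat.central X, P.outputB dat.central X) :=
    (hsmooth.1 X hX).differentiableAt one_ne_zero
  let T : Blocks M P.Q →ₗ[ℝ] (Fin P.Q → H) × Matrix (Fin P.Q) (Fin P.b) ℝ :=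
    { toFun := fun X => (P.output dat.central X, P.outputB dat.central X)
      map_add' := fun X Y => by
        refine Prod.ext ?_ ?_
        · funext c
          simp [output, filterSignal, add_smul, Finset.sum_add_distrib]
        · simp [outputB, Matrix.add_mul, Finset.sum_add_distrib]
      map_smul' := fun a X => by
        refine Prod.ext ?_ ?_
        · funext c
          simp [output, filterSignal, mul_smul, Finset.smul_sum]
        · simp [outputB, Finset.smul_sum] }
  have hT : DifferentiableAt ℝ T X := T.toContinuousLinearMap.differentiableAt
  exact DifferentiableAt.comp X (f := T) hφ hT

theorem convexOn_regularizer (hγ : ConvexOn ℝ Set.univ P.γ) :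
    ConvexOn ℝ Set.univ (P.regularizer dat.central) := by
  let T : Blocks M P.Q →ₗ[ℝ] ∀ k, Matrix (Fin P.Q) (Fin (P.a k)) ℝ :=
    { toFun := fun X k => (X k)ᵀ * dat.A k
      map_add' := fun X Y => by funext k; simp [Matrix.add_mul]
      map_smul' := fun a X => by funext k; simp }
  exact hγ.comp_linearMap T

theorem regularizer_separable (hsep : dat.BlockSeparable) (X U : Blocks M P.Q) :
    P.regularizer dat.central U - P.regularizer dat.central X =
      ∑ k, (P.regularizer dat.central (Function.update X k (U k)) -
        P.regularizer dat.central X) := by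
  obtain ⟨γk, hγk⟩ := hsep
  simp only [hγk, ← Finset.sum_sub_distrib]
  refine Finset.sum_congr rfl fun k _ => ?_
  rw [Finset.sum_eq_single k]
  · rw [Function.update_self]
  · intro l _ hl
    rw [Function.update_of_ne hl, sub_self]
  · simp

theorem mem_stationaryPoints_of_blockwise_min (hsmooth : dat.Smooth) (hsep : dat.BlockSeparable)
    (hγ : ConvexOn ℝ Set.univ P.γ) {X : Blocks M P.Q} (hX : X ∈ dat.feasible)
    (hmin : ∀ U ∈ dat.feasible, ∀ k,
      P.objective dat.central X ≤ P.objective dat.central (Function.update X k (U k))) :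
    X ∈ dat.stationaryPoints :=
  ⟨hX, exists_subdifferential_normalCone (dat.isClosed_feasible hsmooth) hX
    (dat.convexOn_regularizer hγ) fun _ hε => linearized_min_of_blockwise_min
      (dat.differentiableAt_smoothPart hsmooth hX) (dat.regularizer_separable hsep X) hmin hε⟩

/-- Every ultrafilter limit of the iterates is stationary. -/
theorem exists_stationary_limit (hsmooth : dat.Smooth) (hsep : dat.BlockSeparable)
    {agg : ℕ → Aggregation V} {X : ℕ → Blocks M P.Q}
    (hstep : ∀ i, dat.Step (agg i) (X i) (X (i + 1)))
    (hupd : ∃ T : ℕ, ∀ (i : ℕ) (k : V), ∃ j, i ≤ j ∧ j < i + T ∧ (agg j).q = k)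
    (hcont : dat.ContinuityAssumption) (hsim : ∀ i, dat.SimilarSolutions (agg i))
    (hfeas : ∀ i, dat.FeasibleSetContinuity (agg i)) (𝒰 : Ultrafilter ℕ)
    (h𝒰 : (𝒰 : Filter ℕ) ≤ atTop) :
    ∃ Xb ∈ dat.stationaryPoints, Tendsto X 𝒰 (𝓝 Xb) := by
  obtain ⟨hL, hcomp, hγ⟩ := hcont
  let L := P.objective dat.central
  have hF : ∀ i, X (i + 1) ∈ dat.feasible := fun i => (hstep i).mem_feasible
  -- Descent starts at index 1, since the initial filter may be infeasible.
  have hdesc : ∀ i, L (X (i + 1 + 1)) ≤ L (X (i + 1)) := fun i => by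
    have hid : (agg (i + 1)).update (X (i + 1))
        ((agg (i + 1)).localVariable (X (i + 1) (agg (i + 1)).q) fun _ => 1) = X (i + 1) := by
      rw [Aggregation.update_localVariable_one, Function.update_eq_self]
    have := (hstep (i + 1)).objective_le dat _ _ (hid.symm ▸ hF i)
    rwa [hid] at this
  have hanti : Antitone fun i => L (X (i + 1)) := antitone_nat_of_succ_le hdesc
  let K : Set (Blocks M P.Q) := {U | U ∈ dat.feasible ∧ L U ≤ L (X 1)}
  have hK : IsCompact K := hcomp _
  have hXK : ∀ i, X (i + 1) ∈ K := fun i => ⟨hF i, hanti (Nat.zero_le i)⟩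
  have hbdd : BddBelow (Set.range fun i => L (X (i + 1))) :=
    (hK.bddBelow_image (hL.mono fun U hU => hU.1)).mono <| by
      rintro _ ⟨i, rfl⟩
      exact ⟨_, hXK i, rfl⟩
  obtain ⟨c, hc⟩ : ∃ c, Tendsto (fun i => L (X i)) atTop (𝓝 c) :=
    ⟨_, (tendsto_add_atTop_iff_nat 1).1 (tendsto_atTop_ciInf hanti hbdd)⟩
  have hshift : ∀ s, Tendsto (fun i => i + s) (𝒰 : Filter ℕ) atTop := fun s =>
    (tendsto_add_atTop_nat s).mono_left h𝒰
  have hevK : ∀ s, ∀ᶠ i in (𝒰 : Filter ℕ), X (i + s) ∈ K := fun s => by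
    filter_upwards [(hshift s).eventually (eventually_ge_atTop 1)] with i hi
    obtain ⟨j, hj⟩ := Nat.exists_eq_add_of_le' hi
    rw [hj]
    exact hXK j
  have hlim : ∀ s, ∃ Y ∈ K, Tendsto (fun i => X (i + s)) 𝒰 (𝓝 Y) := fun s =>
    hK.ultrafilter_le_nhds (𝒰.map fun i => X (i + s)) (le_principal_iff.2 (hevK s))
  choose Y hYK hY using hlim
  have hYL : ∀ s, L (Y s) = c := fun s => by
    have h1 : Tendsto (fun i => L (X (i + s))) 𝒰 (𝓝 (L (Y s))) :=
      (hL _ (hYK s).1).tendsto.comp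
        (tendsto_nhdsWithin_iff.2 ⟨hY s, (hevK s).mono fun _ h => h.1⟩)
    exact tendsto_nhds_unique h1 (hc.comp (hshift s))
  have hagg : ∀ s, ∃ a, ∀ᶠ i in (𝒰 : Filter ℕ), agg (i + s) = a := fun s => by
    obtain ⟨a, ha⟩ := Ultrafilter.eq_pure_of_finite (𝒰.map fun i => agg (i + s))
    refine ⟨a, ?_⟩
    have : {a} ∈ 𝒰.map fun i => agg (i + s) := by rw [ha]; exact Set.mem_singleton a
    exact this
  choose a ha using hagg
  have hone : ∀ s, columnSpace (Y s) = columnSpace (Y (s + 1)) ∧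
      ∀ W, (a s).update (Y s) W ∈ dat.feasible → L (Y s) ≤ L ((a s).update (Y s) W) := fun s => by
    obtain ⟨i, hi⟩ := (ha s).exists
    refine dat.limit_step (a s) (hi ▸ hsim (i + s)) (hi ▸ hfeas (i + s)) hL 𝒰 (hY s) (hY (s + 1))
      ((hevK s).mono fun _ h => h.1) (hYK s).1 (hYK (s + 1)).1 ?_ ((hYL s).trans (hYL (s + 1)).symm)
    filter_upwards [ha s] with i hi
    rw [← hi]
    exact hstep (i + s)
  have hcol : ∀ s, columnSpace (Y 0) = columnSpace (Y s) := fun s => by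
    induction s with
    | zero => rfl
    | succ s ih => exact ih.trans (hone s).1
  -- Some `i` realizes the limiting aggregations for all `s < T` at once, and within that window
  -- every node updates.
  have hk : ∀ k, ∃ s, (a s).q = k := fun k => by
    obtain ⟨T, hT⟩ := hupd
    have h1 : ∀ᶠ i in (𝒰 : Filter ℕ), ∀ s ∈ Finset.range T, agg (i + s) = a s :=
      (Finset.eventually_all _).2 fun s _ => ha s
    obtain ⟨i, hi⟩ := h1.exists
    obtain ⟨j, hij, hjT, hj⟩ := hT i k
    obtain ⟨s, rfl⟩ := Nat.exists_eq_add_of_le hij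
    exact ⟨s, by rw [← hi s (Finset.mem_range.2 (by omega)), hj]⟩
  refine ⟨Y 0, dat.mem_stationaryPoints_of_blockwise_min hsmooth hsep hγ (hYK 0).1 ?_,
    by simpa using hY 0⟩
  intro U hU k
  obtain ⟨s, rfl⟩ := hk k
  obtain ⟨R, hR⟩ := exists_eq_mul_of_columnSpace_le (hcol s).le
  -- Since `Y 0 = Y s * R`, the filter `Y 0` with block `q` replaced is an update of `Y s`.
  obtain ⟨W, hW⟩ := (a s).exists_update_eq (fun _ => R) (fun l _ _ => hR l)
    ((a s).localVariable (U (a s).q) fun _ => 1)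
  rw [Aggregation.update_localVariable_one] at hW
  rw [hW]
  have hmem := dat.update_mem_feasible (hYK 0).1 hU (a s).q
  rw [hW] at hmem
  exact ((hYL 0).trans (hYL s).symm).le.trans ((hone s).2 W hmem)

end Functions.GlobalData

end Central

end NSDASF

theorem mainTheorem1
    {V : Type*} [Fintype V] [DecidableEq V]
    {H : Type*} [NormedAddCommGroup H] [NormedSpace ℝ H]
    (P : NSDASF.Functions V H) (M : V → ℕ) (dat : P.GlobalData M)
    (hsmooth : dat.Smooth) (hsep : dat.BlockSeparable)
    (agg : ℕ → NSDASF.Aggregation V) (X : ℕ → NSDASF.Blocks M P.Q)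
    (hrun : dat.IsFullyConnectedRun agg X ∨
      ∃ G : SimpleGraph V, G.Connected ∧ dat.IsTreeRun G agg X)
    (hupd : ∃ T : ℕ, ∀ (i : ℕ) (k : V), ∃ j, i ≤ j ∧ j < i + T ∧ (agg j).q = k)
    (hcont : dat.ContinuityAssumption)
    (hsim : ∀ i, dat.SimilarSolutions (agg i))
    (hfeas : ∀ i, dat.FeasibleSetContinuity (agg i))
    (hqual : ∀ Xbar, MapClusterPt Xbar atTop X → ∀ i, dat.CompressedLICQ (agg i) Xbar) :
    ∀ δ : ℝ, 0 < δ → ∃ T : ℕ, ∀ i, T < i →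
      ∃ Xs ∈ dat.stationaryPoints, NSDASF.frobNorm (Xs - X i) < δ := by
  have hstep : ∀ i, dat.Step (agg i) (X i) (X (i + 1)) := by
    rcases hrun with h | ⟨G, -, h⟩
    exacts [h.2, h.2]
  intro δ hδ
  suffices h : ∀ᶠ i in atTop, ∃ Xs ∈ dat.stationaryPoints, NSDASF.frobNorm (Xs - X i) < δ by
    obtain ⟨T, hT⟩ := eventually_atTop.1 h
    exact ⟨T, fun i hi => hT i hi.le⟩
  by_contra hbad
  rw [not_eventually, frequently_iff_neBot] at hbad
  -- An ultrafilter concentrated on the bad indices: its limit is stationary, yet lies within `δ` of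
  -- some bad iterate.
  let 𝒰 := Ultrafilter.of
    (atTop ⊓ 𝓟 {i | ¬ ∃ Xs ∈ dat.stationaryPoints, NSDASF.frobNorm (Xs - X i) < δ})
  have h𝒰 : (𝒰 : Filter ℕ) ≤ _ := Ultrafilter.of_le _
  obtain ⟨Xb, hXb, hlim⟩ := dat.exists_stationary_limit hsmooth hsep hstep hupd hcont hsim hfeas 𝒰
    (h𝒰.trans inf_le_left)
  have hnorm : Continuous fun U : NSDASF.Blocks M P.Q => NSDASF.frobNorm (Xb - U) := by
    simp only [← NSDASF.norm_blocksEquiv]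
    exact ((NSDASF.blocksEquiv M P.Q).continuous.comp (continuous_const.sub continuous_id)).norm
  have hzero : NSDASF.frobNorm (Xb - Xb) < δ := by
    rw [← NSDASF.norm_blocksEquiv, sub_self, map_zero, norm_zero]
    exact hδ
  have hgood := ((hnorm.tendsto Xb).comp hlim).eventually (gt_mem_nhds hzero)
  obtain ⟨i, hi1, hi2⟩ := (hgood.and (le_principal_iff.1 (h𝒰.trans inf_le_right))).exists
  exact hi2 ⟨Xb, hXb, hi1⟩
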